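/- \textbf{Construction.} Let $0<b<1$ and let $(\alpha_n)_{n\ge 1}$ be real numbers with $\alpha_n>0$, $\alpha_{n+1}<\alpha_n$, $\alpha_{n+1}/\alpha_n\to 1$, $\sum_{n\ge1}\alpha_n<2(1-b)$ and $\alpha_1<2b$. Put $\ell_0=2b$ and $\ell_n=\alpha_n/2^n$ for $n\ge1$. The atom of the empty word is $[-1,1]$. Inductively, for a word $w\in\{0,1\}^n$, $n\ge 0$, the gap $I^*_w$ is the open interval of length $\ell_n$ with the same centre as the atom $I_w$, and $I_{w0}$, $I_{w1}$ are the left and right closed intervals forming $I_w\setminus I^*_w$. In particular $I_0=[-1,-b]$, $I_1=[b,1]$, and the gap of generation $0$ is $(-b,b)$. Let $K=\bigcap_{n\ge1}\bigcup_{w\in\{0,1\}^n}I_w$. A \emph{Bowen map} for $b,(\alpha_n)$ is a map $f:[-1,1]\to[-1,1]$ such that: (i) for every $n\ge0$ and every word $a_0a_1\dots a_n$, $f$ maps $I^*_{a_0a_1\dots a_n}$ onto $I^*_{a_1\dots a_n}$ (the gap $(-b,b)$ if $n=0$), is $C^1$ with $f'>1$ on $I^*_{a_0\dots a_n}$, and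 $f'(x)\to2$ as $x$ tends, from inside this gap, to either of its endpoints; (ii) there is a sequence $\varepsilon_n\to0$ such that $|f'(x)-2|<\varepsilon_n$ for all $n\ge1$ and all $x$ in a gap of generation $n+1$; (iii) $f$ is continuous on $I_0$ and on $I_1$; (iv) $f$ maps $(-b,b)$ onto $(-1,1)$, is $C^1$ with $f'>1$ there, and $f'(x)\to2$ as $x\to -b^+$ and as $x\to b^-$. \textbf{Proposition.} Bowen maps exist for all such $b$ and $(\alpha_n)$. For every Bowen map $f$: (1) $f$ induces a map $\hat f$ of the circle $S^1=[-1,1]/(-1\sim1)$ which is $C^1$ and expanding (there is $\lambda>1$ with $|\hat f'|\ge\lambda$), and $\hat f$ is not $C^{1+s}$ for any $s>0$. (2) $K$ is a Cantor set (compact, perfect, totally disconnected) with positive Lebesgue measure, $m(K)>0$, and it is dynamically defined by $f$: $K=\{x : f^n(x)\in I_0\cup I_1\text{ for all }n\ge0\}$. (3) The normalized Lebesgue measure $\mu_K(B)=m(B\cap K)/m(K)$ is invariant, both as a measure on $S^1$ under $\hat f$ and as a measure on $K\subset[-1,1]$ under $f|_K:K\to K$; the projection $[-1,1]\to S^1$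 carries the latter measure to the former. (4) $\mu_K$ is Bernoulli: the itinerary map $h:K\to\{0,1\}^{\mathbb N}$, defined by $f^n(x)\in I_{h(x)_n}$ for all $n\ge0$, is a bijection that is measurable with measurable inverse, satisfies $h\circ f|_K=\sigma\circ h$ where $\sigma(a_0a_1a_2\dots)=a_1a_2\dots$, and carries $\mu_K$ to the Bernoulli measure $\nu$ on $\{0,1\}^{\mathbb N}$ that gives weight $1/2$ to each symbol. -/

import Mathlib

open Set Filter Topology MeasureTheory

namespace Bowen

/-- The parameters of the construction: a number `0 < b < 1` and numbers `α 1, α 2, ...` (the value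
`α 0` is not used). -/
structure IsBowenData (b : ℝ) (α : ℕ → ℝ) : Prop where
  b_pos : 0 < b
  b_lt_one : b < 1
  pos : ∀ n, 1 ≤ n → 0 < α n
  summable : Summable fun n => α (n + 1)
  tsum_lt : ∑' n, α (n + 1) < 2 * (1 - b)
  strictAnti : ∀ n, 1 ≤ n → α (n + 1) < α n
  tendsto_ratio : Tendsto (fun n => α (n + 1) / α n) atTop (𝓝 1)
  first_lt : α 1 < 2 * b

/-- The length of the gaps of generation `n`: it is `2 * b` for `n = 0` and `α n / 2 ^ n` for
`n ≥ 1`. -/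
noncomputable def gapLength (b : ℝ) (α : ℕ → ℝ) (n : ℕ) : ℝ :=
  if n = 0 then 2 * b else α n / 2 ^ n

/-- The endpoints of the atom of generation `n` given by the word `a 0, ..., a (n - 1)` (the later
terms of `a` are not used). The atom of the empty word is `[-1, 1]`. The atom of the word
`a 0, ..., a n` is the left (if `a n = 0`) or right (if `a n = 1`) part that remains when the
concentric open interval of length `gapLength b α n` is removed from the atom of the word
`a 0, ..., a (n - 1)`. -/
noncomputable def atomEnds (b : ℝ) (α : ℕ → ℝ) (a : ℕ → Fin 2) : ℕ → ℝ × ℝ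
  | 0 => (-1, 1)
  | n + 1 =>
    if a n = 0 then
      ((atomEnds b α a n).1,
        ((atomEnds b α a n).1 + (atomEnds b α a n).2) / 2 - gapLength b α n / 2)
    else
      (((atomEnds b α a n).1 + (atomEnds b α a n).2) / 2 + gapLength b α n / 2,
        (atomEnds b α a n).2)

/-- The atom of generation `n` of the word `a 0, ..., a (n - 1)`. -/
def atom (b : ℝ) (α : ℕ → ℝ) (a : ℕ → Fin 2) (n : ℕ) : Set ℝ :=
  Icc (atomEnds b α a n).1 (atomEnds b α a n).2

/-- The left endpoint of the gap of generation `n` in the atom `atom b α a n`. -/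
noncomputable def gapLeft (b : ℝ) (α : ℕ → ℝ) (a : ℕ → Fin 2) (n : ℕ) : ℝ :=
  ((atomEnds b α a n).1 + (atomEnds b α a n).2) / 2 - gapLength b α n / 2

/-- The right endpoint of the gap of generation `n` in the atom `atom b α a n`. -/
noncomputable def gapRight (b : ℝ) (α : ℕ → ℝ) (a : ℕ → Fin 2) (n : ℕ) : ℝ :=
  ((atomEnds b α a n).1 + (atomEnds b α a n).2) / 2 + gapLength b α n / 2

/-- The gap of generation `n` in the atom `atom b α a n`: an open interval with the same centre as
the atom. The gap of generation `0` is `(-b, b)`. -/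
def gap (b : ℝ) (α : ℕ → ℝ) (a : ℕ → Fin 2) (n : ℕ) : Set ℝ :=
  Ioo (gapLeft b α a n) (gapRight b α a n)

/-- The Cantor set: the intersection over `n ≥ 1` of the unions of the atoms of generation `n`. -/
def cantorSet (b : ℝ) (α : ℕ → ℝ) : Set ℝ :=
  ⋂ n : ℕ, ⋃ a : ℕ → Fin 2, atom b α a (n + 1)

/-- The atoms of generation one, `I₀ = [-1, -b]` and `I₁ = [b, 1]`. -/
def firstAtom (b : ℝ) (i : Fin 2) : Set ℝ :=
  if i = 0 then Icc (-1) (-b) else Icc b 1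

/-- The shift `(a 0, a 1, a 2, ...) ↦ (a 1, a 2, ...)` on sequences of zeros and ones. -/
def shift (a : ℕ → Fin 2) : ℕ → Fin 2 := fun n => a (n + 1)

/-- `f` restricts to an order preserving `C¹` expanding map from the open interval `(p, q)` onto the
open interval `(p', q')`, whose derivative tends to `2` at both ends of `(p, q)`. -/
structure IsExpandingPiece (f : ℝ → ℝ) (p q p' q' : ℝ) : Prop where
  contDiffOn : ContDiffOn ℝ 1 f (Ioo p q)
  one_lt_deriv : ∀ x ∈ Ioo p q, 1 < deriv f x
  image_eq : f '' Ioo p q = Ioo p' q'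
  tendsto_left : Tendsto (deriv f) (𝓝[>] p) (𝓝 2)
  tendsto_right : Tendsto (deriv f) (𝓝[<] q) (𝓝 2)

/-- `f : [-1, 1] → [-1, 1]` (a real function whose values outside `[-1, 1]` are irrelevant) is a map
given by Bowen's construction: each gap of generation `n + 1` is mapped onto the gap of
generation `n` obtained by deleting the first letter of the word, with derivative uniformly close
to `2` when `n` is large; `f` is continuous on `[-1, -b]` and on `[b, 1]`; and `(-b, b)` is mapped
onto `(-1, 1)`. -/
structure IsBowenMap (b : ℝ) (α : ℕ → ℝ) (f : ℝ → ℝ) : Prop where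
  gap_piece : ∀ (a : ℕ → Fin 2) (n : ℕ), IsExpandingPiece f
    (gapLeft b α a (n + 1)) (gapRight b α a (n + 1))
    (gapLeft b α (shift a) n) (gapRight b α (shift a) n)
  deriv_near_two : ∃ ε : ℕ → ℝ, Tendsto ε atTop (𝓝 0) ∧
    ∀ n, 1 ≤ n → ∀ a : ℕ → Fin 2, ∀ x ∈ gap b α a (n + 1), |deriv f x - 2| < ε n
  continuousOn_left : ContinuousOn f (Icc (-1) (-b))
  continuousOn_right : ContinuousOn f (Icc b 1)
  central_piece : IsExpandingPiece f (-b) b (-1) 1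

/-- The circle `[-1, 1] / (-1 ∼ 1)`, that is, `ℝ / 2ℤ`. -/
abbrev Circle2 : Type := AddCircle (2 : ℝ)

instance factTwoPos : Fact ((0 : ℝ) < 2) := ⟨two_pos⟩

/-- The self-map of the circle `[-1, 1] / (-1 ∼ 1)` induced by `f`. -/
noncomputable def circleMap (f : ℝ → ℝ) : Circle2 → Circle2 :=
  AddCircle.liftIco (2 : ℝ) (-1) fun x => ((f x : ℝ) : Circle2)

/-- `φ : ℝ → ℝ` is a `C¹` lift of the circle map `F`. The `C¹` maps of the circle are those that
have such a lift, the lift is then unique up to an additive constant, and its derivative is the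
derivative of `F`. -/
def IsC1Lift (F : Circle2 → Circle2) (φ : ℝ → ℝ) : Prop :=
  ContDiff ℝ 1 φ ∧ ∀ x : ℝ, F (x : Circle2) = ((φ x : ℝ) : Circle2)

/-- `F` is a `C¹` expanding map of the circle. -/
def IsC1Expanding (F : Circle2 → Circle2) : Prop :=
  ∃ φ : ℝ → ℝ, IsC1Lift F φ ∧ ∃ l : ℝ, 1 < l ∧ ∀ x, l ≤ |deriv φ x|

/-- `F` is a `C¹` map of the circle whose derivative is Hölder continuous with exponent `s`. -/
def IsC1Holder (s : ℝ) (F : Circle2 → Circle2) : Prop :=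
  ∃ φ : ℝ → ℝ, IsC1Lift F φ ∧ ∃ C : ℝ, 0 < C ∧ ∀ x y : ℝ,
    |deriv φ x - deriv φ y| ≤ C * dist (x : Circle2) (y : Circle2) ^ s

/-- The normalized Lebesgue measure on the Cantor set, `B ↦ m (B ∩ K) / m K`, as a measure on the
line. -/
noncomputable def muLine (b : ℝ) (α : ℕ → ℝ) : Measure ℝ :=
  ProbabilityTheory.cond volume (cantorSet b α)

/-- The same measure on the subspace `K`. -/
noncomputable def muK (b : ℝ) (α : ℕ → ℝ) : Measure (cantorSet b α) :=
  (muLine b α).comap Subtype.val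

/-- The image of the Cantor set in the circle. -/
def circleCantorSet (b : ℝ) (α : ℕ → ℝ) : Set Circle2 :=
  (fun x : ℝ => (x : Circle2)) '' cantorSet b α

/-- The normalized Lebesgue measure on the Cantor set in the circle. -/
noncomputable def muCircle (b : ℝ) (α : ℕ → ℝ) : Measure Circle2 :=
  ProbabilityTheory.cond volume (circleCantorSet b α)

/-- The Bernoulli measure on sequences of zeros and ones that gives weight `1 / 2` to each
symbol. -/
noncomputable def bernoulliMeasure : Measure (ℕ → Fin 2) :=
  Measure.infinitePi fun _ => (PMF.uniformOfFintype (Fin 2)).toMeasure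

end Bowen

namespace Bowen

/-! All atoms of generation `n` have the same length `L n` (`atomLength`), so an atom is determined
by its left endpoint `-1 + ∑ a k * s k` with `s k` the step `atomStep`. Hence `K` is the set of
points `point b α a = -1 + ∑ a k * s k`, and the coding by sequences of letters is a homeomorphism.
Changing one letter translates the point, so the `2 ^ n` cylinders of length `n` have equal Lebesgue
measure in `K` (`volume_image_cylinder`): normalized Lebesgue measure on `K` is the image of the
Bernoulli measure. Positive measure holds because the gaps have total length less than `2`.

A Bowen map is recovered from its derivative. Let `D` be `f'` on the gaps and `2` elsewhere. The
limits at the gap endpoints and the uniform closeness to `2` in high generations make `D`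
continuous. The crucial fact is that the integral of `D` over an atom of generation `n + 1` is
exactly `L n` (`IsBowenDensity.integral_atom`): gaps are expanded exactly, so the error on an atom
is the sum of the errors on its two subatoms, while the error on one atom of generation `n` is `o(2
^ (-n))`. So the primitive of `D`, up to translation on each branch, maps every atom onto that of
the shifted word. It agrees with `f` on the gaps, hence by continuity of `f` on the two first atoms
it agrees with `f` on `[-1, 1]` (`IsBowenMap.eq_bowenMap`). Therefore `f (point a) = point (shift
a)`, and invariance reduces to that of the Bernoulli measure under the shift.

On the circle, `D` takes the value `2` at both `-1` and `1`, so its periodic extension is continuous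
and its primitive is a `C¹` lift of degree `3`; compactness gives a uniform expansion constant. If
the derivative were Hölder, the mean value theorem on the gaps would bound `α n / α (n + 1)` by `1 +
C * θ ^ n` with `θ < 1`; the product of these ratios would be bounded, against `α n → 0`.

For existence, an explicit density is placed on each gap with the prescribed mean. Monotonicity of
`α` and `α 1 < 2 * b` make the required mean greater than `2` off the central gap, and the
convergence of the ratios makes it tend to `2`. -/

/-- The numerical value of a letter. -/
def digit (i : Fin 2) : ℝ := (i : ℕ)

@[simp] lemma digit_zero : digit 0 = 0 := by simp [digit]

@[simp] lemma digit_one : digit 1 = 1 := by simp [digit]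

lemma digit_nonneg (i : Fin 2) : 0 ≤ digit i := by simp [digit]

lemma digit_le_one (i : Fin 2) : digit i ≤ 1 := by fin_cases i <;> simp

lemma eq_zero_or_eq_one (i : Fin 2) : i = 0 ∨ i = 1 := by fin_cases i <;> simp

/-- The common length of the atoms of generation `n`. -/
noncomputable def atomLength (b : ℝ) (α : ℕ → ℝ) : ℕ → ℝ
  | 0 => 2
  | n + 1 => (atomLength b α n - gapLength b α n) / 2

/-- The distance between the left endpoints of the two atoms of generation `n + 1` in an atom of
generation `n`. -/
noncomputable def atomStep (b : ℝ) (α : ℕ → ℝ) (n : ℕ) : ℝ :=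
  atomLength b α (n + 1) + gapLength b α n

/-- The left endpoint of an atom. -/
noncomputable def atomLeft (b : ℝ) (α : ℕ → ℝ) (a : ℕ → Fin 2) (n : ℕ) : ℝ :=
  -1 + ∑ k ∈ Finset.range n, digit (a k) * atomStep b α k

/-! ### Explicit formulas for atoms and gaps. -/

section Geometry

variable {b : ℝ} {α : ℕ → ℝ} {a a' : ℕ → Fin 2} {n m : ℕ} {x : ℝ}

lemma atomLength_zero : atomLength b α 0 = 2 := rfl

lemma atomLength_succ :
    atomLength b α n = 2 * atomLength b α (n + 1) + gapLength b α n := by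
  simp only [atomLength]; ring

lemma atomLength_eq_add_step :
    atomLength b α n = atomStep b α n + atomLength b α (n + 1) := by
  rw [atomLength_succ, atomStep]; ring

@[simp] lemma atomLeft_zero : atomLeft b α a 0 = -1 := by simp [atomLeft]

lemma atomLeft_succ :
    atomLeft b α a (n + 1) = atomLeft b α a n + digit (a n) * atomStep b α n := by
  simp only [atomLeft, Finset.sum_range_succ]; ring

lemma atomLeft_congr (h : ∀ i < n, a i = a' i) : atomLeft b α a n = atomLeft b α a' n := by
  unfold atomLeft
  congr 1
  exact Finset.sum_congr rfl fun k hk => by rw [h k (Finset.mem_range.1 hk)]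

/-- Since the length depends only on the generation, the midpoint recursion unwinds to a sum to
which each letter contributes independently. All later arguments use this form. -/
lemma atomEnds_eq (b : ℝ) (α : ℕ → ℝ) (a : ℕ → Fin 2) (n : ℕ) :
    atomEnds b α a n = (atomLeft b α a n, atomLeft b α a n + atomLength b α n) := by
  induction n with
  | zero => simp [atomEnds, atomLength]; norm_num
  | succ n ih =>
    have h := atomLength_succ (b := b) (α := α) (n := n)
    rcases eq_zero_or_eq_one (a n) with h0 | h0
    · simp only [atomEnds, ih, h0, atomLeft_succ, if_true, digit_zero, Prod.mk.injEq]
      constructor <;> linarith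
    · simp only [atomEnds, ih, h0, atomLeft_succ, digit_one, Prod.mk.injEq, atomStep,
        one_ne_zero, if_false]
      constructor <;> linarith

lemma mem_atom : x ∈ atom b α a n ↔
    atomLeft b α a n ≤ x ∧ x ≤ atomLeft b α a n + atomLength b α n := by
  simp [atom, atomEnds_eq]

lemma gapLeft_eq : gapLeft b α a n = atomLeft b α a n + atomLength b α (n + 1) := by
  have h := atomLength_succ (b := b) (α := α) (n := n)
  simp only [gapLeft, atomEnds_eq]; linarith

lemma gapRight_eq : gapRight b α a n = atomLeft b α a n + atomStep b α n := by
  have h := atomLength_succ (b := b) (α := α) (n := n)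
  simp only [gapRight, atomEnds_eq, atomStep]; linarith

lemma gapRight_eq_gapLeft_add : gapRight b α a n = gapLeft b α a n + gapLength b α n := by
  rw [gapRight_eq, gapLeft_eq, atomStep]; ring

lemma mem_gap : x ∈ gap b α a n ↔ atomLeft b α a n + atomLength b α (n + 1) < x ∧
    x < atomLeft b α a n + atomStep b α n := by
  simp [gap, gapLeft_eq, gapRight_eq]

lemma gapLeft_zero : gapLeft b α a 0 = -b := by simp [gapLeft, atomEnds, gapLength]

lemma gapRight_zero : gapRight b α a 0 = b := by simp [gapRight, atomEnds, gapLength]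

lemma gap_zero : gap b α a 0 = Ioo (-b) b := by rw [gap, gapLeft_zero, gapRight_zero]

lemma gapLeft_congr (h : ∀ i < n, a i = a' i) : gapLeft b α a n = gapLeft b α a' n := by
  rw [gapLeft_eq, gapLeft_eq, atomLeft_congr h]

lemma gap_congr (h : ∀ i < n, a i = a' i) : gap b α a n = gap b α a' n := by
  rw [gap, gap, gapRight_eq_gapLeft_add, gapRight_eq_gapLeft_add, gapLeft_congr h]

lemma isOpen_gap : IsOpen (gap b α a n) := isOpen_Ioo

/-- The total length of the gaps of generation `n`. -/
noncomputable def gapTotal (b : ℝ) (α : ℕ → ℝ) (n : ℕ) : ℝ := 2 ^ n * gapLength b α n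

lemma gapTotal_zero : gapTotal b α 0 = 2 * b := by simp [gapTotal, gapLength]

lemma gapTotal_succ : gapTotal b α (n + 1) = α (n + 1) := by
  simp [gapTotal, gapLength]; field_simp

lemma gapLength_eq : gapLength b α n = gapTotal b α n / 2 ^ n := by
  simp [gapTotal]

lemma two_pow_mul_atomLength :
    2 ^ n * atomLength b α n = 2 - ∑ k ∈ Finset.range n, gapTotal b α k := by
  induction n with
  | zero => simp [atomLength]
  | succ n ih =>
    rw [Finset.sum_range_succ, gapTotal]
    have h := atomLength_succ (b := b) (α := α) (n := n)
    rw [h] at ih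
    rw [pow_succ]; linarith

lemma notMem_gap_of_mem_atom_succ (hx : x ∈ atom b α a (n + 1)) :
    x ∉ gap b α a n := by
  rw [mem_gap]
  rw [mem_atom, atomLeft_succ] at hx
  rcases eq_zero_or_eq_one (a n) with h0 | h0 <;> rw [h0] at hx <;> simp at hx <;> intro h <;>
    linarith [hx.1, hx.2]

lemma exists_mem_atom_of_notMem_gap (hx : x ∈ Icc (-1 : ℝ) 1) (h : ∀ a n, x ∉ gap b α a n)
    (n : ℕ) : ∃ a, x ∈ atom b α a n := by
  induction n with
  | zero =>
    refine ⟨0, ?_⟩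
    rw [mem_atom, atomLeft_zero, atomLength_zero]
    exact ⟨hx.1, by linarith [hx.2]⟩
  | succ n ih =>
    obtain ⟨a, ha⟩ := ih
    have hg := h a n
    rw [mem_gap, not_and_or, not_lt, not_lt] at hg
    rw [mem_atom] at ha
    have e : ∀ i : Fin 2, atomLeft b α (Function.update a n i) (n + 1) =
        atomLeft b α a n + digit i * atomStep b α n := fun i => by
      rw [atomLeft_succ, Function.update_self,
        atomLeft_congr (a' := a) fun j hj => Function.update_of_ne hj.ne _ _]
    have h4 := atomLength_eq_add_step (b := b) (α := α) (n := n)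
    rcases hg with hg | hg
    · refine ⟨Function.update a n 0, ?_⟩
      rw [mem_atom, e]
      simp; exact ⟨ha.1, hg⟩
    · refine ⟨Function.update a n 1, ?_⟩
      rw [mem_atom, e]
      simp; exact ⟨hg, by linarith [ha.2]⟩

lemma mem_cantorSet_of_notMem_gap (hx : x ∈ Icc (-1 : ℝ) 1) (h : ∀ a n, x ∉ gap b α a n) :
    x ∈ cantorSet b α := by
  simp only [cantorSet, mem_iInter, mem_iUnion]
  exact fun n => exists_mem_atom_of_notMem_gap hx h (n + 1)

end Geometry

/-! ### Positivity of the lengths, nesting of atoms, disjointness of gaps. -/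

section Data

variable {b : ℝ} {α : ℕ → ℝ} (hα : IsBowenData b α) {a a' : ℕ → Fin 2} {n m : ℕ} {x : ℝ}

include hα

lemma IsBowenData.gapTotal_pos (n : ℕ) : 0 < gapTotal b α n := by
  cases n with
  | zero => rw [gapTotal_zero]; linarith [hα.b_pos]
  | succ n => rw [gapTotal_succ]; exact hα.pos _ (by omega)

lemma IsBowenData.summable_gapTotal : Summable (gapTotal b α) := by
  rw [← summable_nat_add_iff 1]
  simpa only [gapTotal_succ] using hα.summable

lemma IsBowenData.tsum_gapTotal_lt : ∑' n, gapTotal b α n < 2 := by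
  rw [hα.summable_gapTotal.tsum_eq_zero_add]
  simp only [gapTotal_succ, gapTotal_zero]
  linarith [hα.tsum_lt]

lemma IsBowenData.tendsto_gapTotal : Tendsto (gapTotal b α) atTop (𝓝 0) :=
  hα.summable_gapTotal.tendsto_atTop_zero

lemma IsBowenData.gapLength_pos (n : ℕ) : 0 < gapLength b α n := by
  rw [gapLength_eq]; exact div_pos (hα.gapTotal_pos n) (by positivity)

lemma IsBowenData.atomLength_pos (n : ℕ) : 0 < atomLength b α n := by
  have h := two_pow_mul_atomLength (b := b) (α := α) (n := n)
  have h1 : ∑ k ∈ Finset.range n, gapTotal b α k ≤ ∑' n, gapTotal b α n :=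
    hα.summable_gapTotal.sum_le_tsum _ fun i _ => (hα.gapTotal_pos i).le
  have h2 := hα.tsum_gapTotal_lt
  have h3 : 0 < 2 ^ n * atomLength b α n := by linarith
  exact pos_of_mul_pos_right h3 (by positivity)

lemma IsBowenData.atomStep_pos (n : ℕ) : 0 < atomStep b α n :=
  add_pos (hα.atomLength_pos _) (hα.gapLength_pos _)

lemma IsBowenData.atomLength_le (n : ℕ) : atomLength b α n ≤ 2 / 2 ^ n := by
  rw [le_div_iff₀ (by positivity), mul_comm, two_pow_mul_atomLength]
  linarith [Finset.sum_nonneg fun i (_ : i ∈ Finset.range n) => (hα.gapTotal_pos i).le]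

lemma IsBowenData.tendsto_atomLength : Tendsto (atomLength b α) atTop (𝓝 0) := by
  refine squeeze_zero (fun n => (hα.atomLength_pos n).le) hα.atomLength_le ?_
  have := (tendsto_pow_atTop_nhds_zero_of_lt_one (r := (1 / 2 : ℝ)) (by norm_num)
    (by norm_num)).const_mul 2
  simpa [div_eq_mul_inv] using this

lemma IsBowenData.gapLeft_lt_gapRight : gapLeft b α a n < gapRight b α a n := by
  rw [gapRight_eq_gapLeft_add]; linarith [hα.gapLength_pos n]

lemma IsBowenData.atom_succ_subset : atom b α a (n + 1) ⊆ atom b α a n := by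
  intro x hx
  rw [mem_atom] at hx ⊢
  rw [atomLeft_succ] at hx
  have h1 := digit_nonneg (a n)
  have h2 := digit_le_one (a n)
  have h3 := hα.atomStep_pos n
  have h4 := atomLength_eq_add_step (b := b) (α := α) (n := n)
  constructor <;> nlinarith

lemma IsBowenData.atom_anti : Antitone (atom b α a) :=
  antitone_nat_of_succ_le fun _ => hα.atom_succ_subset

lemma IsBowenData.gap_subset_atom : gap b α a n ⊆ atom b α a n := by
  intro x hx
  rw [mem_gap] at hx
  rw [mem_atom]
  have h3 := hα.atomLength_pos (n + 1)
  have h4 := atomLength_eq_add_step (b := b) (α := α) (n := n)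
  constructor <;> linarith

/-- At the first letter where two words differ, the two subatoms are separated by a gap of positive
length. -/
lemma IsBowenData.eq_of_mem_atom (hx : x ∈ atom b α a n) (hx' : x ∈ atom b α a' n) :
    ∀ i < n, a i = a' i := by
  induction n with
  | zero => intro i hi; omega
  | succ n ih =>
    have h := ih (hα.atom_succ_subset hx) (hα.atom_succ_subset hx')
    intro i hi
    rcases Nat.lt_succ_iff_lt_or_eq.1 hi with hi | rfl
    · exact h i hi
    · rw [mem_atom, atomLeft_succ] at hx hx'
      rw [← atomLeft_congr h] at hx'
      have h1 := hα.gapLength_pos i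
      simp only [atomStep] at hx hx'
      rcases eq_zero_or_eq_one (a i) with h0 | h0 <;>
        rcases eq_zero_or_eq_one (a' i) with h0' | h0' <;> rw [h0, h0'] <;>
        rw [h0] at hx <;> rw [h0'] at hx' <;> simp at hx hx' <;> linarith [hx.1, hx.2, hx'.1, hx'.2]

lemma IsBowenData.notMem_gap_of_mem_atom (hx : x ∈ atom b α a n) (hm : m < n) :
    x ∉ gap b α a' m := by
  intro h
  have hx' : x ∈ atom b α a (m + 1) := hα.atom_anti hm hx
  have e := hα.eq_of_mem_atom (hα.atom_succ_subset hx') (hα.gap_subset_atom h)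
  rw [← gap_congr e] at h
  exact notMem_gap_of_mem_atom_succ hx' h

lemma IsBowenData.eq_of_mem_gap (hx : x ∈ gap b α a n) (hx' : x ∈ gap b α a' m) :
    n = m ∧ ∀ i < n, a i = a' i := by
  have h : n = m := by
    rcases lt_trichotomy n m with h | h | h
    · exact absurd hx (hα.notMem_gap_of_mem_atom (hα.gap_subset_atom hx') h)
    · exact h
    · exact absurd hx' (hα.notMem_gap_of_mem_atom (hα.gap_subset_atom hx) h)
  subst h
  exact ⟨rfl, hα.eq_of_mem_atom (hα.gap_subset_atom hx) (hα.gap_subset_atom hx')⟩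

lemma IsBowenData.atom_subset_Icc : atom b α a n ⊆ Icc (-1) 1 := by
  intro x hx
  have := hα.atom_anti (Nat.zero_le n) hx
  rw [mem_atom, atomLeft_zero, atomLength_zero] at this
  exact ⟨this.1, by linarith [this.2]⟩

lemma IsBowenData.gap_subset_Icc : gap b α a n ⊆ Icc (-1) 1 :=
  hα.gap_subset_atom.trans hα.atom_subset_Icc

lemma IsBowenData.cantorSet_subset_Icc : cantorSet b α ⊆ Icc (-1) 1 := by
  intro x hx
  simp only [cantorSet, mem_iInter, mem_iUnion] at hx
  obtain ⟨a', ha'⟩ := hx 0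
  exact hα.atom_subset_Icc ha'

end Data

/-! ### Coding of `K` by sequences; topology and Lebesgue measure of `K`. -/

/-- The point of the Cantor set with a given itinerary. -/
noncomputable def point (b : ℝ) (α : ℕ → ℝ) (a : ℕ → Fin 2) : ℝ :=
  -1 + ∑' k, digit (a k) * atomStep b α k

section Coding

variable {b : ℝ} {α : ℕ → ℝ} (hα : IsBowenData b α) {a a' : ℕ → Fin 2} {n m : ℕ} {x : ℝ}

include hα

lemma IsBowenData.digit_mul_atomStep_nonneg (i : Fin 2) (k : ℕ) :
    0 ≤ digit i * atomStep b α k :=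
  mul_nonneg (digit_nonneg i) (hα.atomStep_pos k).le

lemma IsBowenData.digit_mul_atomStep_le (i : Fin 2) (k : ℕ) :
    digit i * atomStep b α k ≤ 2 / 2 ^ k := by
  have h1 := hα.atomStep_pos k
  have h2 := hα.atomLength_pos (k + 1)
  have h3 := atomLength_eq_add_step (b := b) (α := α) (n := k)
  have h4 := hα.atomLength_le k
  nlinarith [digit_le_one i]

omit hα in
lemma summable_two_div_two_pow : Summable fun k : ℕ => (2 : ℝ) / 2 ^ k := by
  simpa [div_eq_mul_inv] using
    (summable_geometric_of_lt_one (r := (1 / 2 : ℝ)) (by norm_num) (by norm_num)).mul_left 2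

lemma IsBowenData.summable_digit (a : ℕ → Fin 2) :
    Summable fun k => digit (a k) * atomStep b α k :=
  summable_two_div_two_pow.of_nonneg_of_le (fun _ => hα.digit_mul_atomStep_nonneg _ _)
    fun _ => hα.digit_mul_atomStep_le _ _

lemma IsBowenData.tendsto_atomLeft (a : ℕ → Fin 2) :
    Tendsto (atomLeft b α a) atTop (𝓝 (point b α a)) :=
  (hα.summable_digit a).hasSum.tendsto_sum_nat.const_add (-1)

lemma IsBowenData.atomLeft_mem_atom (h : n ≤ m) : atomLeft b α a m ∈ atom b α a n := by
  refine hα.atom_anti h ?_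
  rw [mem_atom]
  exact ⟨le_rfl, by linarith [hα.atomLength_pos m]⟩

omit hα in
lemma isClosed_atom : IsClosed (atom b α a n) := isClosed_Icc

lemma IsBowenData.point_mem_atom : point b α a ∈ atom b α a n :=
  isClosed_atom.mem_of_tendsto (hα.tendsto_atomLeft a)
    (eventually_atTop.2 ⟨n, fun _ h => hα.atomLeft_mem_atom h⟩)

lemma IsBowenData.eq_point_of_mem_atom (h : ∀ n, x ∈ atom b α a n) : x = point b α a := by
  have h1 : Tendsto (fun n => atomLeft b α a n + atomLength b α n) atTop (𝓝 (point b α a + 0)) :=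
    (hα.tendsto_atomLeft a).add hα.tendsto_atomLength
  rw [add_zero] at h1
  exact le_antisymm (ge_of_tendsto' h1 fun n => (mem_atom.1 (h n)).2)
    (le_of_tendsto' (hα.tendsto_atomLeft a) fun n => (mem_atom.1 (h n)).1)

lemma IsBowenData.point_injective : Function.Injective (point b α) := by
  intro a a' h
  ext1 i
  have h' : point b α a ∈ atom b α a' (i + 1) := h ▸ hα.point_mem_atom
  exact hα.eq_of_mem_atom hα.point_mem_atom h' i (Nat.lt_succ_self i)

omit hα in
lemma continuous_digit : Continuous digit := continuous_of_discreteTopology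

lemma IsBowenData.continuous_point : Continuous (point b α) := by
  refine continuous_const.add (continuous_tsum (u := fun k : ℕ => (2 : ℝ) / 2 ^ k) (fun k => ?_)
    summable_two_div_two_pow fun k a => ?_)
  · exact (continuous_digit.comp (continuous_apply k)).mul continuous_const
  · rw [Real.norm_of_nonneg (hα.digit_mul_atomStep_nonneg _ _)]
    exact hα.digit_mul_atomStep_le _ _

omit hα in
lemma continuous_atomLeft : Continuous fun a => atomLeft b α a n :=
  continuous_const.add (continuous_finsetSum _ fun k _ =>
    (continuous_digit.comp (continuous_apply k)).mul continuous_const)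

lemma IsBowenData.range_point : range (point b α) = cantorSet b α := by
  apply Subset.antisymm
  · rintro _ ⟨a, rfl⟩
    simp only [cantorSet, mem_iInter, mem_iUnion]
    exact fun n => ⟨a, hα.point_mem_atom⟩
  · intro x hx
    simp only [cantorSet, mem_iInter, mem_iUnion] at hx
    -- The words of the atoms containing `x` may come from a different sequence for each generation;
    -- compactness of the sequence space yields a single sequence that serves for all of them.
    have hc : ∀ n, IsClosed {a | x ∈ atom b α a n} := fun n => by
      simp only [mem_atom]
      exact (isClosed_le continuous_atomLeft continuous_const).inter
        (isClosed_le continuous_const (continuous_atomLeft.add continuous_const))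
    obtain ⟨a, ha⟩ := IsCompact.nonempty_iInter_of_sequence_nonempty_isCompact_isClosed
      (fun n => {a | x ∈ atom b α a n}) (fun n a h => hα.atom_succ_subset h)
      (fun n => (hx n).imp fun a h => hα.atom_succ_subset h) (hc 0).isCompact hc
    rw [mem_iInter] at ha
    exact ⟨a, (hα.eq_point_of_mem_atom ha).symm⟩

lemma IsBowenData.point_mem_cantorSet : point b α a ∈ cantorSet b α :=
  hα.range_point ▸ mem_range_self a

lemma IsBowenData.isClosedEmbedding_point : IsClosedEmbedding (point b α) :=
  hα.continuous_point.isClosedEmbedding hα.point_injective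

lemma IsBowenData.isCompact_cantorSet : IsCompact (cantorSet b α) :=
  hα.range_point ▸ isCompact_range hα.continuous_point

lemma IsBowenData.measurableSet_cantorSet : MeasurableSet (cantorSet b α) :=
  hα.isCompact_cantorSet.measurableSet

lemma IsBowenData.isTotallyDisconnected_cantorSet : IsTotallyDisconnected (cantorSet b α) := by
  rw [← hα.range_point, hα.isClosedEmbedding_point.isEmbedding.isTotallyDisconnected_range]
  infer_instance

lemma IsBowenData.perfect_cantorSet : Perfect (cantorSet b α) := by
  refine ⟨hα.isCompact_cantorSet.isClosed, ?_⟩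
  rw [← hα.range_point]
  rintro _ ⟨a, rfl⟩
  rw [accPt_iff_frequently]
  -- In `Fin 2`, adding `1` flips the letter, so these are sequences different from `a` that
  -- converge to it.
  have h1 : Tendsto (fun n => Function.update a n (a n + 1)) atTop (𝓝 a) := by
    rw [tendsto_pi_nhds]
    intro i
    refine tendsto_const_nhds.congr' (eventually_atTop.2 ⟨i + 1, fun n hn => ?_⟩)
    exact (Function.update_of_ne (by omega) _ _).symm
  refine ((hα.continuous_point.tendsto a).comp h1).frequently (Frequently.of_forall fun n => ?_)
  refine ⟨fun h => ?_, mem_range_self _⟩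
  have := congrFun (hα.point_injective h) n
  simp at this

/-- The coding of the Cantor set. -/
noncomputable def IsBowenData.pointHomeomorph : (ℕ → Fin 2) ≃ₜ cantorSet b α :=
  hα.isClosedEmbedding_point.isEmbedding.toHomeomorph.trans (Homeomorph.setCongr hα.range_point)

lemma IsBowenData.volume_cantorSet_pos : 0 < volume (cantorSet b α) := by
  have h1 : Icc (-1 : ℝ) 1 ⊆ cantorSet b α ∪ ⋃ n, ⋃ a, gap b α a n := by
    intro x hx
    by_cases h : ∀ a n, x ∉ gap b α a n
    · exact Or.inl (mem_cantorSet_of_notMem_gap hx h)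
    · push Not at h
      obtain ⟨a, n, h⟩ := h
      exact Or.inr (mem_iUnion₂.2 ⟨n, a, h⟩)
  have h2 : ∀ n, volume (⋃ a, gap b α a n) ≤ ENNReal.ofReal (gapTotal b α n) := by
    intro n
    -- A gap depends only on the first `n` letters, so the union runs over `2 ^ n` words, each
    -- continued by zeros.
    have e : (⋃ a, gap b α a n) =
        ⋃ w : Fin n → Fin 2, gap b α (fun k => if h : k < n then w ⟨k, h⟩ else 0) n := by
      apply Subset.antisymm
      · refine iUnion_subset fun a => ?_
        refine subset_iUnion_of_subset (fun k => a k) (gap_congr fun i hi => ?_).le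
        simp [hi]
      · exact iUnion_subset fun w => subset_iUnion (fun a => gap b α a n) _
    rw [e]
    refine (measure_iUnion_le _).trans ?_
    simp only [gap, Real.volume_Ioo, gapRight_eq_gapLeft_add, add_sub_cancel_left]
    rw [tsum_fintype, Finset.sum_const, gapTotal, ENNReal.ofReal_mul (by positivity)]
    simp [ENNReal.ofReal_pow]
  have h3 : volume (Icc (-1 : ℝ) 1) ≤
      volume (cantorSet b α) + ENNReal.ofReal (∑' n, gapTotal b α n) := by
    refine (measure_mono h1).trans ((measure_union_le _ _).trans ?_)
    gcongr
    rw [ENNReal.ofReal_tsum_of_nonneg (fun n => (hα.gapTotal_pos n).le) hα.summable_gapTotal]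
    exact (measure_iUnion_le _).trans (ENNReal.tsum_le_tsum h2)
  rw [pos_iff_ne_zero]
  intro h
  rw [h, zero_add, Real.volume_Icc, ENNReal.ofReal_le_ofReal_iff
    (tsum_nonneg fun n => (hα.gapTotal_pos n).le)] at h3
  linarith [hα.tsum_gapTotal_lt]

lemma IsBowenData.volume_cantorSet_ne_top : volume (cantorSet b α) ≠ ⊤ :=
  hα.isCompact_cantorSet.measure_lt_top.ne

lemma IsBowenData.point_update (a : ℕ → Fin 2) (n : ℕ) (i : Fin 2) :
    point b α (Function.update a n i) =
      point b α a + (digit i - digit (a n)) * atomStep b α n := by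
  have h := (hα.summable_digit (Function.update a n i)).tsum_sub (hα.summable_digit a)
  rw [tsum_eq_single n fun k hk => by rw [Function.update_of_ne hk, sub_self],
    Function.update_self] at h
  simp only [point]
  linarith

/-- Replacing letter `n` translates the point by a multiple of `atomStep b α n`. So the two halves
of a cylinder are translates of each other inside `K`, and each step of the induction halves the
measure. -/
lemma IsBowenData.volume_image_cylinder (a : ℕ → Fin 2) (n : ℕ) :
    2 ^ n * volume (point b α '' PiNat.cylinder a n) = volume (cantorSet b α) := by
  have hshift : ∀ n i, volume (point b α '' PiNat.cylinder (Function.update a n i) (n + 1)) =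
      volume (point b α '' PiNat.cylinder a (n + 1)) := by
    intro n i
    have e : point b α '' PiNat.cylinder (Function.update a n i) (n + 1) =
        (fun x => x + (digit i - digit (a n)) * atomStep b α n) ''
          (point b α '' PiNat.cylinder a (n + 1)) := by
      rw [image_image]
      ext x
      constructor
      · rintro ⟨c, hc, rfl⟩
        have hn : c n = i := by simpa using hc n (Nat.lt_succ_self n)
        refine ⟨Function.update c n (a n), fun j hj => ?_, ?_⟩
        · rcases eq_or_ne j n with rfl | hj'
          · simp
          · rw [Function.update_of_ne hj', hc j hj, Function.update_of_ne hj']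
        · simp only [hα.point_update, hn]; ring
      · rintro ⟨c, hc, rfl⟩
        refine ⟨Function.update c n i, fun j hj => ?_, ?_⟩
        · rcases eq_or_ne j n with rfl | hj'
          · simp
          · rw [Function.update_of_ne hj', hc j hj, Function.update_of_ne hj']
        · simp only [hα.point_update, hc n (Nat.lt_succ_self n)]
    rw [e, image_add_right, measure_preimage_add_right]
  induction n with
  | zero => simp [← hα.range_point]
  | succ n ih =>
    have e : PiNat.cylinder a n = PiNat.cylinder (Function.update a n 0) (n + 1) ∪
        PiNat.cylinder (Function.update a n 1) (n + 1) := by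
      ext c
      simp only [PiNat.cylinder, mem_union, mem_ofPred_eq, Nat.lt_succ_iff_lt_or_eq]
      constructor
      · intro h
        refine (eq_zero_or_eq_one (c n)).imp ?_ ?_ <;>
        · rintro h0 i (hi | rfl)
          · rw [Function.update_of_ne hi.ne, h i hi]
          · rw [Function.update_self, h0]
      · rintro (h | h) i hi <;> rw [h i (Or.inl hi), Function.update_of_ne hi.ne]
    have hd : Disjoint (PiNat.cylinder (Function.update a n 0) (n + 1))
        (PiNat.cylinder (Function.update a n 1) (n + 1)) := by
      rw [Set.disjoint_left]
      intro c h0 h1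
      have h0 := h0 n (Nat.lt_succ_self n)
      have h1 := h1 n (Nat.lt_succ_self n)
      simp [h0] at h1
    rw [e, image_union, measure_union ((disjoint_image_iff hα.point_injective).2 hd)
      (hα.isClosedEmbedding_point.measurableEmbedding.measurableSet_image.2
        (PiNat.isOpen_cylinder _ _ _).measurableSet), hshift, hshift] at ih
    rw [← ih]; ring

end Coding

/-! ### The Bernoulli measure and its invariance under the shift. -/

instance isProbabilityMeasure_bernoulliMeasure : IsProbabilityMeasure bernoulliMeasure := by
  unfold bernoulliMeasure; infer_instance

lemma bernoulliMeasure_pi_singleton (s : Finset ℕ) (a : ℕ → Fin 2) :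
    bernoulliMeasure ((s : Set ℕ).pi fun i => {a i}) = (2⁻¹) ^ s.card := by
  rw [bernoulliMeasure, Measure.infinitePi_pi _ fun i _ => measurableSet_singleton _]
  simp

lemma bernoulliMeasure_cylinder (a : ℕ → Fin 2) (n : ℕ) :
    bernoulliMeasure (PiNat.cylinder a n) = (2⁻¹) ^ n := by
  have := bernoulliMeasure_pi_singleton (Finset.range n) a
  rwa [Finset.card_range, ← PiNat.cylinder_eq_pi] at this

lemma measure_ext_cylinder {μ ν : Measure (ℕ → Fin 2)} [IsFiniteMeasure μ]
    (h : ∀ a n, μ (PiNat.cylinder a n) = ν (PiNat.cylinder a n)) : μ = ν := by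
  have hB := (PiNat.isTopologicalBasis_cylinders fun _ : ℕ => Fin 2).borel_eq_generateFrom
  rw [← BorelSpace.measurable_eq] at hB
  refine ext_of_generate_finite _ hB ?_ ?_ ?_
  · rintro _ ⟨a, n, rfl⟩ _ ⟨a', m, rfl⟩ ⟨c, hc, hc'⟩
    -- Two cylinders that share a point `c` are cylinders around `c`, so they are nested and the
    -- cylinders form a π-system.
    refine ⟨c, max n m, ?_⟩
    rw [← PiNat.mem_cylinder_iff_eq.1 hc, ← PiNat.mem_cylinder_iff_eq.1 hc']
    ext d
    simp only [PiNat.cylinder, mem_inter_iff, mem_ofPred_eq, lt_max_iff]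
    exact ⟨fun h i hi => hi.elim (h.1 i) (h.2 i), fun h => ⟨fun i hi => h i (Or.inl hi),
      fun i hi => h i (Or.inr hi)⟩⟩
  · rintro _ ⟨a, n, rfl⟩
    exact h a n
  · simpa using h 0 0

lemma continuous_shift : Continuous shift :=
  continuous_pi fun n => continuous_apply (n + 1)

lemma measurePreserving_shift : MeasurePreserving shift bernoulliMeasure bernoulliMeasure := by
  refine ⟨continuous_shift.measurable, ?_⟩
  have := Measure.isProbabilityMeasure_map (μ := bernoulliMeasure)
    continuous_shift.measurable.aemeasurable
  refine measure_ext_cylinder fun a n => ?_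
  rw [Measure.map_apply continuous_shift.measurable (PiNat.isOpen_cylinder _ _ _).measurableSet,
    bernoulliMeasure_cylinder]
  have e : shift ⁻¹' PiNat.cylinder a n =
      (((Finset.range n).image Nat.succ : Finset ℕ) : Set ℕ).pi fun i => {a (i - 1)} := by
    ext c
    simp [PiNat.cylinder, shift]
  rw [e, bernoulliMeasure_pi_singleton _ fun i => a (i - 1),
    Finset.card_image_of_injective _ Nat.succ_injective, Finset.card_range]

/-! ### Lebesgue measure on `K` as the image of the Bernoulli measure. -/

section Measures

variable {b : ℝ} {α : ℕ → ℝ} (hα : IsBowenData b α)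

include hα

lemma IsBowenData.muLine_compl : muLine b α (cantorSet b α)ᶜ = 0 := by
  rw [muLine, ProbabilityTheory.cond_apply hα.measurableSet_cantorSet]
  simp

lemma IsBowenData.map_muK : (muK b α).map Subtype.val = muLine b α := by
  rw [muK, (MeasurableEmbedding.subtype_coe hα.measurableSet_cantorSet).map_comap,
    Subtype.range_coe]
  exact Measure.restrict_eq_self_of_ae_mem (mem_ae_iff.2 hα.muLine_compl)

lemma IsBowenData.measurePreserving_pointHomeomorph_symm :
    MeasurePreserving hα.pointHomeomorph.symm (muK b α) bernoulliMeasure := by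
  have hm : Measurable hα.pointHomeomorph.symm := hα.pointHomeomorph.symm.continuous.measurable
  refine ⟨hm, ?_⟩
  symm
  refine measure_ext_cylinder fun a n => ?_
  have hms := (PiNat.isOpen_cylinder (fun _ => Fin 2) a n).measurableSet
  rw [Measure.map_apply hm hms, muK,
    (MeasurableEmbedding.subtype_coe hα.measurableSet_cantorSet).comap_apply]
  have e : Subtype.val '' (hα.pointHomeomorph.symm ⁻¹' PiNat.cylinder a n) =
      point b α '' PiNat.cylinder a n := by
    rw [← Homeomorph.coe_symm_toEquiv, ← Equiv.image_eq_preimage_symm, image_image]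
    rfl
  have hsub : point b α '' PiNat.cylinder a n ⊆ cantorSet b α :=
    hα.range_point ▸ image_subset_range _ _
  rw [e, muLine, ProbabilityTheory.cond_apply hα.measurableSet_cantorSet,
    inter_eq_self_of_subset_right hsub, bernoulliMeasure_cylinder, ← hα.volume_image_cylinder a n]
  have h0 : volume (point b α '' PiNat.cylinder a n) ≠ 0 := fun h =>
    hα.volume_cantorSet_pos.ne' (by rw [← hα.volume_image_cylinder a n, h, mul_zero])
  have h1 : volume (point b α '' PiNat.cylinder a n) ≠ ⊤ :=
    ((measure_mono hsub).trans_lt hα.volume_cantorSet_ne_top.lt_top).ne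
  rw [ENNReal.mul_inv (Or.inl (by simp)) (Or.inr h0), mul_assoc, ENNReal.inv_mul_cancel h0 h1,
    mul_one, ENNReal.inv_pow]

lemma IsBowenData.map_point : bernoulliMeasure.map (point b α) = muLine b α := by
  have h := hα.measurePreserving_pointHomeomorph_symm
  rw [← h.map_eq, Measure.map_map hα.continuous_point.measurable h.measurable, ← hα.map_muK]
  congr 1
  ext x
  exact congrArg Subtype.val (hα.pointHomeomorph.apply_symm_apply x)

lemma IsBowenData.measurePreserving_coe_circle :
    MeasurePreserving (fun x : ℝ => (x : Circle2)) (muLine b α) (muCircle b α) := by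
  have hmk := AddCircle.measurePreserving_mk (2 : ℝ) (-1)
  norm_num at hmk
  have hcc : IsCompact (circleCantorSet b α) :=
    hα.isCompact_cantorSet.image (AddCircle.continuous_mk' 2)
  have hmc : MeasurableSet (circleCantorSet b α) := hcc.measurableSet
  -- The projection is injective on `[-1, 1]` except that it glues `-1` to `1`, so the two sets can
  -- differ only at these two points.
  have key : ((fun x : ℝ => (x : Circle2)) ⁻¹' circleCantorSet b α ∩ Ioc (-1) 1 : Set ℝ) =ᵐ[volume]
      cantorSet b α := by
    have hf : ∀ᵐ x : ℝ, x ∉ ({-1, 1} : Set ℝ) :=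
      measure_eq_zero_iff_ae_notMem.1 ((Set.toFinite ({-1, 1} : Set ℝ)).measure_zero volume)
    refine eventuallyEq_set.2 ?_
    filter_upwards [hf] with x hx
    simp only [mem_insert_iff, mem_singleton_iff, not_or] at hx
    constructor
    · rintro ⟨⟨y, hy, hxy⟩, hx1⟩
      have hy1 := hα.cantorSet_subset_Icc hy
      have hy2 : y ≠ -1 := by
        rintro rfl
        exact hx.1 ((AddCircle.coe_eq_coe_iff_of_mem_Ico (p := (2 : ℝ)) (a := -1) (x := -1)
          (by norm_num) ⟨hx1.1.le, by linarith [lt_of_le_of_ne hx1.2 hx.2]⟩).1 hxy).symm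
      rwa [← (AddCircle.coe_eq_coe_iff_of_mem_Ioc (p := (2 : ℝ)) (a := -1)
        ⟨lt_of_le_of_ne hy1.1 (Ne.symm hy2), by linarith [hy1.2]⟩
        ⟨hx1.1, by linarith [hx1.2]⟩).1 hxy]
    · intro h
      have := hα.cantorSet_subset_Icc h
      exact ⟨⟨x, h, rfl⟩, lt_of_le_of_ne this.1 (Ne.symm hx.1), this.2⟩
  have h1 := hmk.restrict_preimage hmc
  have h2 : volume (circleCantorSet b α) = volume (cantorSet b α) := by
    rw [← hmk.measure_preimage hmc.nullMeasurableSet,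
      Measure.restrict_apply (hmk.measurable hmc), measure_congr key]
  rw [Measure.restrict_restrict (hmk.measurable hmc), Measure.restrict_congr_set key] at h1
  rw [muLine, muCircle, ProbabilityTheory.cond, ProbabilityTheory.cond, h2]
  exact h1.smul_measure _

end Measures

/-! ### Densities, their continuity, and their integrals over atoms. -/

/-- A function that is equal to `2` off the gaps, is greater than `1` and continuous on the gaps,
tends to `2` at the ends of the gaps, and is uniformly close to `2` on the gaps of high
generation. -/
structure IsGapDensity (b : ℝ) (α : ℕ → ℝ) (D : ℝ → ℝ) : Prop where
  eq_two : ∀ x, (∀ a n, x ∉ gap b α a n) → D x = 2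
  one_lt_of_mem : ∀ a n, ∀ x ∈ gap b α a n, 1 < D x
  continuousOn_gap : ∀ a n, ContinuousOn D (gap b α a n)
  tendsto_left : ∀ a n, Tendsto D (𝓝[>] (gapLeft b α a n)) (𝓝 2)
  tendsto_right : ∀ a n, Tendsto D (𝓝[<] (gapRight b α a n)) (𝓝 2)
  near_two : ∀ η > 0, ∃ N, ∀ n, N ≤ n → ∀ a, ∀ x ∈ gap b α a n, |D x - 2| < η

/-- A gap density that expands each gap exactly to the gap of the shifted word. -/
structure IsBowenDensity (b : ℝ) (α : ℕ → ℝ) (D : ℝ → ℝ) : Prop extends IsGapDensity b α D where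
  integral_central : ∫ t in (-b)..b, D t = 2
  integral_gap : ∀ a n, ∫ t in (gapLeft b α a (n + 1))..(gapRight b α a (n + 1)), D t =
    gapLength b α n

/-- The primitive with value `-1` at `-1`. -/
noncomputable def primitive (D : ℝ → ℝ) (x : ℝ) : ℝ := -1 + ∫ t in (-1)..x, D t

section Primitive

variable {D : ℝ → ℝ}

lemma primitive_sub (hD : Continuous D) (x y : ℝ) :
    primitive D y - primitive D x = ∫ t in x..y, D t := by
  have := intervalIntegral.integral_interval_sub_left (μ := volume) (hD.intervalIntegrable (-1) y)
    (hD.intervalIntegrable (-1) x)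
  simp only [primitive]; linarith

lemma hasDerivAt_primitive (hD : Continuous D) (x : ℝ) : HasDerivAt (primitive D) (D x) x :=
  (intervalIntegral.integral_hasDerivAt_right (hD.intervalIntegrable _ _)
    (hD.stronglyMeasurableAtFilter _ _) hD.continuousAt).const_add _

lemma continuous_primitive (hD : Continuous D) : Continuous (primitive D) :=
  continuous_iff_continuousAt.2 fun x => (hasDerivAt_primitive hD x).continuousAt

lemma strictMono_primitive (hD : Continuous D) (hpos : ∀ x, 0 < D x) :
    StrictMono (primitive D) :=
  strictMono_of_deriv_pos fun x => by rw [(hasDerivAt_primitive hD x).deriv]; exact hpos x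

lemma primitive_neg_one : primitive D (-1) = -1 := by simp [primitive]

end Primitive

lemma StrictMono.image_Ioo_eq {F : ℝ → ℝ} (hF : StrictMono F) (hc : Continuous F) {p q : ℝ}
    (hpq : p < q) : F '' Ioo p q = Ioo (F p) (F q) := by
  apply Subset.antisymm
  · rintro _ ⟨x, hx, rfl⟩
    exact ⟨hF hx.1, hF hx.2⟩
  · exact intermediate_value_Ioo hpq.le hc.continuousOn

section Density

variable {b : ℝ} {α : ℕ → ℝ} {D : ℝ → ℝ} {a a' : ℕ → Fin 2} {n m : ℕ} {x : ℝ}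

lemma IsGapDensity.eventually_near_two_of_notMem (hD : IsGapDensity b α D)
    (hx : x ∉ gap b α a n) {η : ℝ} (hη : 0 < η) :
    ∀ᶠ y in 𝓝 x, y ∈ gap b α a n → |D y - 2| < η := by
  have hball : ∀ᶠ z in 𝓝 (2 : ℝ), |z - 2| < η :=
    Metric.ball_mem_nhds (2 : ℝ) hη
  rcases lt_trichotomy x (gapLeft b α a n) with h | rfl | h
  · filter_upwards [Iio_mem_nhds h] with y hy hy'
    exact absurd hy'.1 (not_lt.2 (le_of_lt hy))
  · filter_upwards [eventually_nhdsWithin_iff.1 ((hD.tendsto_left a n).eventually hball)] with y hy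
    exact fun hy' => hy hy'.1
  · have h' : gapRight b α a n ≤ x := by
      by_contra! h'
      exact hx ⟨h, h'⟩
    rcases h'.eq_or_lt with rfl | h'
    · filter_upwards [eventually_nhdsWithin_iff.1 ((hD.tendsto_right a n).eventually hball)]
        with y hy
      exact fun hy' => hy hy'.2
    · filter_upwards [Ioi_mem_nhds h'] with y hy hy'
      exact absurd hy'.2 (not_lt.2 (le_of_lt hy))

lemma IsGapDensity.continuous (hD : IsGapDensity b α D) : Continuous D := by
  rw [continuous_iff_continuousAt]
  intro x
  by_cases hx : ∀ a n, x ∉ gap b α a n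
  · rw [ContinuousAt, hD.eq_two x hx, Metric.tendsto_nhds]
    intro η hη
    obtain ⟨N, hN⟩ := hD.near_two η hη
    -- Gaps of generation at least `N` are handled by `near_two`. Only finitely many gaps remain,
    -- and for each of them the one-sided limits at its endpoints give a neighbourhood.
    have h1 : ∀ᶠ y in 𝓝 x, ∀ n : Fin N, ∀ w : Fin n → Fin 2,
        y ∈ gap b α (fun k => if h : k < n then w ⟨k, h⟩ else 0) n → |D y - 2| < η :=
      eventually_all.2 fun n => eventually_all.2 fun w =>
        hD.eventually_near_two_of_notMem (hx _ _) hη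
    filter_upwards [h1] with y hy
    rw [Real.dist_eq]
    by_cases hy' : ∀ a n, y ∉ gap b α a n
    · simpa [hD.eq_two y hy'] using hη
    · push Not at hy'
      obtain ⟨a, n, hn⟩ := hy'
      rcases le_or_gt N n with h | h
      · exact hN n h a y hn
      · refine hy ⟨n, h⟩ (fun k => a k) ?_
        rwa [gap_congr (a' := a) fun i hi => by simp [hi]]
  · push Not at hx
    obtain ⟨a, n, hn⟩ := hx
    exact (hD.continuousOn_gap a n).continuousAt (isOpen_gap.mem_nhds hn)

lemma IsGapDensity.one_lt (hD : IsGapDensity b α D) (x : ℝ) : 1 < D x := by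
  by_cases hx : ∀ a n, x ∉ gap b α a n
  · rw [hD.eq_two x hx]; norm_num
  · push Not at hx
    obtain ⟨a, n, hn⟩ := hx
    exact hD.one_lt_of_mem a n x hn

lemma IsGapDensity.strictMono_primitive (hD : IsGapDensity b α D) : StrictMono (primitive D) :=
  Bowen.strictMono_primitive hD.continuous fun x => zero_lt_one.trans (hD.one_lt x)

variable (hα : IsBowenData b α)

include hα

lemma IsGapDensity.near_two_of_mem_atom (hD : IsGapDensity b α D) {η : ℝ} (hη : 0 < η) :
    ∃ N, ∀ n, N ≤ n → ∀ a, ∀ x ∈ atom b α a n, |D x - 2| < η := by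
  obtain ⟨N, hN⟩ := hD.near_two η hη
  refine ⟨N, fun n hn a x hx => ?_⟩
  by_cases hx' : ∀ a n, x ∉ gap b α a n
  · simpa [hD.eq_two x hx'] using hη
  · push Not at hx'
    obtain ⟨a', m, hm⟩ := hx'
    refine hN m (hn.trans ?_) a' x hm
    by_contra! h
    exact hα.notMem_gap_of_mem_atom hx h hm

omit hα in
lemma atomLeft_update_zero :
    atomLeft b α (Function.update a n 0) (n + 1) = atomLeft b α a n := by
  rw [atomLeft_succ, Function.update_self, atomLeft_congr (a' := a) fun j hj =>
    Function.update_of_ne hj.ne _ _]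
  simp

omit hα in
lemma atomLeft_update_one :
    atomLeft b α (Function.update a n 1) (n + 1) = atomLeft b α a n + atomStep b α n := by
  rw [atomLeft_succ, Function.update_self, atomLeft_congr (a' := a) fun j hj =>
    Function.update_of_ne hj.ne _ _]
  simp

omit hα in
/-- The integral over an atom is the sum of those over its two subatoms and its gap. -/
lemma integral_atom_eq_add (hc : Continuous D) (a : ℕ → Fin 2) (n : ℕ) :
    ∫ t in (atomLeft b α a n)..(atomLeft b α a n + atomLength b α n), D t =
      (∫ t in (atomLeft b α (Function.update a n 0) (n + 1))..
        (atomLeft b α (Function.update a n 0) (n + 1) + atomLength b α (n + 1)), D t) +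
      (∫ t in (gapLeft b α a n)..(gapRight b α a n), D t) +
      ∫ t in (atomLeft b α (Function.update a n 1) (n + 1))..
        (atomLeft b α (Function.update a n 1) (n + 1) + atomLength b α (n + 1)), D t := by
  rw [atomLeft_update_zero, atomLeft_update_one, gapLeft_eq, gapRight_eq,
    add_assoc (atomLeft b α a n) (atomStep b α n), ← atomLength_eq_add_step]
  simp only [← primitive_sub hc]
  ring

omit hα in
lemma IsBowenDensity.integral_atom_sub (hD : IsBowenDensity b α D) (a : ℕ → Fin 2) (n : ℕ) :
    (∫ t in (atomLeft b α a (n + 1))..(atomLeft b α a (n + 1) + atomLength b α (n + 1)), D t) -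
      atomLength b α n =
    ((∫ t in (atomLeft b α (Function.update a (n + 1) 0) (n + 2))..
      (atomLeft b α (Function.update a (n + 1) 0) (n + 2) + atomLength b α (n + 2)), D t) -
        atomLength b α (n + 1)) +
    ((∫ t in (atomLeft b α (Function.update a (n + 1) 1) (n + 2))..
      (atomLeft b α (Function.update a (n + 1) 1) (n + 2) + atomLength b α (n + 2)), D t) -
        atomLength b α (n + 1)) := by
  rw [integral_atom_eq_add hD.continuous, hD.integral_gap]
  linarith [atomLength_succ (b := b) (α := α) (n := n)]

/-- On an atom of high generation `D` is nearly `2`, so the integral is nearly twice the length of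
the atom, which is `atomLength b α n - gapLength b α n`. After multiplication by `2 ^ n` both errors
stay small, the second because `gapTotal` tends to `0`. -/
lemma IsBowenDensity.abs_integral_atom_sub_le (hD : IsBowenDensity b α D) {η : ℝ} (hη : 0 < η) :
    ∃ N, ∀ n, N ≤ n → ∀ a : ℕ → Fin 2,
      2 ^ n * |(∫ t in (atomLeft b α a (n + 1))..
        (atomLeft b α a (n + 1) + atomLength b α (n + 1)), D t) - atomLength b α n| ≤ η := by
  obtain ⟨N, hN⟩ := hD.near_two_of_mem_atom hα (η := η / 2) (by linarith)
  obtain ⟨N', hN'⟩ := eventually_atTop.1 (hα.tendsto_gapTotal.eventually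
    (Iio_mem_nhds (show 0 < η / 2 by linarith)))
  refine ⟨max N N', fun n hn a => ?_⟩
  set p := atomLeft b α a (n + 1)
  set L := atomLength b α (n + 1)
  have hL : 0 < L := hα.atomLength_pos _
  have h1 : |∫ t in p..(p + L), (D t - 2)| ≤ η / 2 * |p + L - p| := by
    rw [← Real.norm_eq_abs]
    refine intervalIntegral.norm_integral_le_of_norm_le_const fun t ht => ?_
    rw [uIoc_of_le (by linarith)] at ht
    exact (hN (n + 1) (by omega) a t (mem_atom.2 ⟨ht.1.le, ht.2⟩)).le
  rw [intervalIntegral.integral_sub (hD.continuous.intervalIntegrable _ _) (by simp),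
    intervalIntegral.integral_const, add_sub_cancel_left, abs_of_pos hL, smul_eq_mul] at h1
  have h2 := atomLength_succ (b := b) (α := α) (n := n)
  have h3 := hα.gapLength_pos n
  have h4 : 2 ^ n * gapLength b α n < η / 2 := hN' n (by omega)
  have h5 : 2 ^ n * L ≤ 1 := by
    have := hα.atomLength_le (n + 1)
    rw [le_div_iff₀ (by positivity), pow_succ] at this
    linarith
  have h6 : |(∫ t in p..(p + L), D t) - atomLength b α n| ≤ η / 2 * L + gapLength b α n := by
    rw [h2]
    rw [abs_le] at h1 ⊢
    constructor <;> linarith [h1.1, h1.2]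
  calc _ ≤ 2 ^ n * (η / 2 * L + gapLength b α n) := by gcongr
    _ = η / 2 * (2 ^ n * L) + 2 ^ n * gapLength b α n := by ring
    _ ≤ η / 2 * 1 + η / 2 := by gcongr
    _ = η := by ring

/-- The error on an atom is the sum of the errors on its two subatoms, so a bound `η / 2 ^ (n + k)`
valid for all words at level `n + k` descends to the bound `η / 2 ^ n` at level `n`. Such bounds
hold for every `η > 0` once `k` is large, so the error vanishes. -/
lemma IsBowenDensity.integral_atom (hD : IsBowenDensity b α D) (a : ℕ → Fin 2) (n : ℕ) :
    ∫ t in (atomLeft b α a (n + 1))..(atomLeft b α a (n + 1) + atomLength b α (n + 1)), D t =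
      atomLength b α n := by
  have key : ∀ η > 0, ∀ (k n : ℕ), (∀ a : ℕ → Fin 2,
      2 ^ (n + k) * |(∫ t in (atomLeft b α a (n + k + 1))..
        (atomLeft b α a (n + k + 1) + atomLength b α (n + k + 1)), D t) -
          atomLength b α (n + k)| ≤ η) → ∀ a : ℕ → Fin 2,
      2 ^ n * |(∫ t in (atomLeft b α a (n + 1))..
        (atomLeft b α a (n + 1) + atomLength b α (n + 1)), D t) - atomLength b α n| ≤ η := by
    intro η hη k
    induction k with
    | zero => exact fun n h => h
    | succ k ih =>
      intro n h a
      have h' := ih (n + 1) (by simpa only [add_assoc, add_comm, add_left_comm] using h)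
      rw [hD.integral_atom_sub]
      have h0 := h' (Function.update a (n + 1) 0)
      have h1 := h' (Function.update a (n + 1) 1)
      refine (mul_le_mul_of_nonneg_left (abs_add_le _ _) (by positivity)).trans ?_
      rw [pow_succ] at h0 h1
      linarith
  rw [← sub_eq_zero, ← abs_nonpos_iff]
  refine le_of_forall_pos_le_add fun η hη => ?_
  obtain ⟨N, hN⟩ := hD.abs_integral_atom_sub_le hα hη
  have h1 := key η hη N n (hN (n + N) (by omega)) a
  have h2 : (1 : ℝ) ≤ 2 ^ n := one_le_pow₀ (by norm_num)
  rw [zero_add]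
  exact (le_mul_of_one_le_left (abs_nonneg _) h2).trans h1

lemma IsBowenDensity.primitive_add_atomLength (hD : IsBowenDensity b α D) (a : ℕ → Fin 2)
    (n : ℕ) : primitive D (atomLeft b α a (n + 1) + atomLength b α (n + 1)) =
      primitive D (atomLeft b α a (n + 1)) + atomLength b α n := by
  have h := hD.integral_atom hα a n
  rw [← primitive_sub hD.continuous] at h
  linarith

lemma IsBowenDensity.primitive_add_atomStep (hD : IsBowenDensity b α D) (a : ℕ → Fin 2) (n : ℕ) :
    primitive D (atomLeft b α a n + atomStep b α n) = primitive D (atomLeft b α a n) +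
      atomLength b α n + ∫ t in (gapLeft b α a n)..(gapRight b α a n), D t := by
  have h := hD.primitive_add_atomLength hα (Function.update a n 0) n
  rw [atomLeft_update_zero] at h
  rw [← primitive_sub hD.continuous, gapLeft_eq, gapRight_eq, h]
  ring

/-- The primitive rises by `2` across the left first atom and by `2` across the central gap, so the
right branch starts at `-1 + 4`; this is the term `4 * digit (a 0)`. -/
lemma IsBowenDensity.primitive_atomLeft (hD : IsBowenDensity b α D) (a : ℕ → Fin 2) (n : ℕ) :
    primitive D (atomLeft b α a (n + 1)) = atomLeft b α (shift a) n + 4 * digit (a 0) := by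
  induction n with
  | zero =>
    have h := hD.primitive_add_atomStep hα a 0
    rw [gapLeft_zero, gapRight_zero, hD.integral_central, atomLength_zero, atomLeft_zero,
      primitive_neg_one] at h
    rw [atomLeft_succ, atomLeft_zero, atomLeft_zero]
    rcases eq_zero_or_eq_one (a 0) with h0 | h0 <;> rw [h0]
    · simp [primitive_neg_one]
    · rw [digit_one, one_mul, h]; norm_num
  | succ n ih =>
    rw [atomLeft_succ (n := n + 1), atomLeft_succ (a := shift a), show shift a n = a (n + 1) from rfl]
    rcases eq_zero_or_eq_one (a (n + 1)) with h0 | h0 <;> rw [h0]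
    · simpa using ih
    · rw [digit_one, one_mul, one_mul, hD.primitive_add_atomStep hα, ih, hD.integral_gap,
        atomStep]
      ring

end Density

/-! ### From a density to a Bowen map. -/

/-- The map of `[-1, 1]` whose derivative is a given density and whose branches start at `-1`. -/
noncomputable def bowenMap (b : ℝ) (D : ℝ → ℝ) (x : ℝ) : ℝ :=
  if x ≤ -b then primitive D x else if x < b then primitive D x - 2 else primitive D x - 4

section Branches

variable {b : ℝ} {α : ℕ → ℝ} {D : ℝ → ℝ} {a a' : ℕ → Fin 2} {n m : ℕ} {x : ℝ}

lemma atom_one : atom b α a 1 = firstAtom b (a 0) := by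
  rcases eq_zero_or_eq_one (a 0) with h | h <;>
    simp [atom, atomEnds, firstAtom, h, gapLength]

variable (hα : IsBowenData b α)

include hα

lemma IsBowenData.atom_succ_subset_firstAtom : atom b α a (n + 1) ⊆ firstAtom b (a 0) := by
  rw [← atom_one (α := α)]
  exact hα.atom_anti (by omega)

lemma IsBowenData.gap_succ_subset_firstAtom : gap b α a (n + 1) ⊆ firstAtom b (a 0) :=
  hα.gap_subset_atom.trans hα.atom_succ_subset_firstAtom

lemma IsBowenData.bowenMap_of_mem_firstAtom {i : Fin 2} (hx : x ∈ firstAtom b i) :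
    bowenMap b D x = primitive D x - 4 * digit i := by
  have hb := hα.b_pos
  rcases eq_zero_or_eq_one i with rfl | rfl
  · simp only [firstAtom, if_true, mem_Icc] at hx
    simp [bowenMap, hx.2]
  · simp only [firstAtom, one_ne_zero, if_false, mem_Icc] at hx
    rw [bowenMap, if_neg (by linarith [hx.1]), if_neg (by linarith [hx.1])]
    simp

omit hα in
lemma bowenMap_of_mem_central (hx : x ∈ Ioo (-b) b) : bowenMap b D x = primitive D x - 2 := by
  rw [bowenMap, if_neg (not_le.2 hx.1), if_pos hx.2]

lemma IsBowenDensity.primitive_gapLeft (hD : IsBowenDensity b α D) (a : ℕ → Fin 2) (n : ℕ) :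
    primitive D (gapLeft b α a (n + 1)) = gapLeft b α (shift a) n + 4 * digit (a 0) := by
  have h := hD.primitive_add_atomLength hα (Function.update a (n + 1) 0) (n + 1)
  rw [atomLeft_update_zero] at h
  rw [gapLeft_eq, h, hD.primitive_atomLeft hα, gapLeft_eq]
  ring

lemma IsBowenDensity.primitive_gapRight (hD : IsBowenDensity b α D) (a : ℕ → Fin 2) (n : ℕ) :
    primitive D (gapRight b α a (n + 1)) = gapRight b α (shift a) n + 4 * digit (a 0) := by
  have h := hD.integral_gap a n
  rw [← primitive_sub hD.continuous, hD.primitive_gapLeft hα] at h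
  rw [gapRight_eq_gapLeft_add (n := n)]
  linarith

lemma IsBowenDensity.primitive_neg_b (hD : IsBowenDensity b α D) : primitive D (-b) = 1 := by
  have h := hD.primitive_add_atomLength hα 0 0
  have h1 := hD.primitive_atomLeft hα 0 0
  have e : atomLeft b α 0 (0 + 1) + atomLength b α (0 + 1) = -b := by
    simp [atomLeft, atomLength, gapLength]; ring
  rw [e, h1] at h
  rw [h, atomLength_zero]
  simp; norm_num

lemma IsBowenDensity.primitive_b (hD : IsBowenDensity b α D) : primitive D b = 3 := by
  have h := hD.integral_central
  rw [← primitive_sub hD.continuous, hD.primitive_neg_b hα] at h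
  linarith

lemma IsBowenDensity.primitive_one (hD : IsBowenDensity b α D) : primitive D 1 = 5 := by
  have h := hD.primitive_add_atomLength hα 1 0
  have h1 := hD.primitive_atomLeft hα 1 0
  have e : atomLeft b α 1 (0 + 1) + atomLength b α (0 + 1) = 1 := by
    simp [atomLeft, atomLength, atomStep, gapLength]; ring
  rw [e, h1] at h
  rw [h, atomLength_zero]
  simp; norm_num

lemma IsBowenDensity.mapsTo_atom (hD : IsBowenDensity b α D) :
    MapsTo (bowenMap b D) (atom b α a (n + 1)) (atom b α (shift a) n) := by
  intro x hx
  rw [hα.bowenMap_of_mem_firstAtom (hα.atom_succ_subset_firstAtom hx)]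
  have hm := hD.strictMono_primitive.monotone
  rw [mem_atom] at hx ⊢
  have h1 := hm hx.1
  have h2 := hm hx.2
  rw [hD.primitive_add_atomLength hα] at h2
  rw [hD.primitive_atomLeft hα] at h1 h2
  constructor <;> linarith

/-- The image lies in every atom of the shifted sequence, and these atoms meet in one point. -/
lemma IsBowenDensity.bowenMap_point (hD : IsBowenDensity b α D) :
    bowenMap b D (point b α a) = point b α (shift a) :=
  hα.eq_point_of_mem_atom fun _ => hD.mapsTo_atom hα hα.point_mem_atom

lemma IsBowenDensity.image_gap (hD : IsBowenDensity b α D) :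
    bowenMap b D '' gap b α a (n + 1) = gap b α (shift a) n := by
  have h1 : bowenMap b D '' gap b α a (n + 1) =
      (fun x => x - 4 * digit (a 0)) '' (primitive D '' gap b α a (n + 1)) := by
    rw [image_image]
    exact image_congr fun x hx => hα.bowenMap_of_mem_firstAtom (hα.gap_succ_subset_firstAtom hx)
  rw [h1, gap, StrictMono.image_Ioo_eq hD.strictMono_primitive (continuous_primitive hD.continuous)
    hα.gapLeft_lt_gapRight, image_sub_const_Ioo, hD.primitive_gapLeft hα, hD.primitive_gapRight hα,
    add_sub_cancel_right, add_sub_cancel_right, gap]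

lemma IsBowenDensity.image_central (hD : IsBowenDensity b α D) :
    bowenMap b D '' Ioo (-b) b = Ioo (-1) 1 := by
  have h1 : bowenMap b D '' Ioo (-b) b = (fun x => x - 2) '' (primitive D '' Ioo (-b) b) := by
    rw [image_image]
    exact image_congr fun x hx => bowenMap_of_mem_central hx
  rw [h1, StrictMono.image_Ioo_eq hD.strictMono_primitive (continuous_primitive hD.continuous)
    (by linarith [hα.b_pos]), image_sub_const_Ioo, hD.primitive_neg_b hα, hD.primitive_b hα]
  norm_num

omit hα in
lemma mem_firstAtom_or_mem_central (hx : x ∈ Icc (-1 : ℝ) 1) :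
    (∃ i, x ∈ firstAtom b i) ∨ x ∈ Ioo (-b) b := by
  rcases le_or_gt x (-b) with h | h
  · exact Or.inl ⟨0, by simp [firstAtom, hx.1, h]⟩
  · rcases lt_or_ge x b with h' | h'
    · exact Or.inr ⟨h, h'⟩
    · exact Or.inl ⟨1, by simp [firstAtom, hx.2, h']⟩

lemma IsBowenDensity.mapsTo_Icc (hD : IsBowenDensity b α D) :
    MapsTo (bowenMap b D) (Icc (-1) 1) (Icc (-1) 1) := by
  intro x hx
  rcases mem_firstAtom_or_mem_central (b := b) hx with ⟨i, hi⟩ | h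
  · rw [← atom_one (α := α) (a := fun _ => i)] at hi
    exact hα.atom_subset_Icc (hD.mapsTo_atom hα hi)
  · exact Ioo_subset_Icc_self (hD.image_central hα ▸ mem_image_of_mem _ h)

omit hα in
lemma isExpandingPiece_of_primitive (hD : IsGapDensity b α D) {f : ℝ → ℝ} {c p q p' q' : ℝ}
    (hpq : p < q) (hf : ∀ x ∈ Ioo p q, f x = primitive D x - c) (himg : f '' Ioo p q = Ioo p' q')
    (hp : Tendsto D (𝓝[>] p) (𝓝 2)) (hq : Tendsto D (𝓝[<] q) (𝓝 2)) :
    IsExpandingPiece f p q p' q' ∧ ∀ x ∈ Ioo p q, deriv f x = D x := by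
  have hder : ∀ x ∈ Ioo p q, deriv f x = D x := fun x hx => by
    have h1 : f =ᶠ[𝓝 x] fun y => primitive D y - c := by
      filter_upwards [isOpen_Ioo.mem_nhds hx] with y hy using hf y hy
    rw [h1.deriv_eq]
    exact ((hasDerivAt_primitive hD.continuous x).sub_const c).deriv
  have hC1 : ContDiff ℝ 1 fun y => primitive D y - c := by
    rw [contDiff_one_iff_deriv]
    refine ⟨fun x => ((hasDerivAt_primitive hD.continuous x).sub_const c).differentiableAt, ?_⟩
    convert hD.continuous using 1
    ext x
    exact ((hasDerivAt_primitive hD.continuous x).sub_const c).deriv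
  refine ⟨⟨hC1.contDiffOn.congr hf, fun x hx => ?_, himg, ?_, ?_⟩, hder⟩
  · rw [hder x hx]; exact hD.one_lt x
  · refine hp.congr' ?_
    filter_upwards [Ioo_mem_nhdsGT hpq] with x hx using (hder x hx).symm
  · refine hq.congr' ?_
    filter_upwards [Ioo_mem_nhdsLT hpq] with x hx using (hder x hx).symm

lemma IsBowenDensity.isExpandingPiece_gap (hD : IsBowenDensity b α D) (a : ℕ → Fin 2) (n : ℕ) :
    IsExpandingPiece (bowenMap b D) (gapLeft b α a (n + 1)) (gapRight b α a (n + 1))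
      (gapLeft b α (shift a) n) (gapRight b α (shift a) n) ∧
    ∀ x ∈ gap b α a (n + 1), deriv (bowenMap b D) x = D x :=
  isExpandingPiece_of_primitive hD.toIsGapDensity hα.gapLeft_lt_gapRight
    (fun _ hx => hα.bowenMap_of_mem_firstAtom (hα.gap_succ_subset_firstAtom hx)) (hD.image_gap hα)
    (hD.tendsto_left _ _) (hD.tendsto_right _ _)

lemma IsBowenDensity.isBowenMap (hD : IsBowenDensity b α D) (hε : ∃ ε : ℕ → ℝ,
    Tendsto ε atTop (𝓝 0) ∧ ∀ n, 1 ≤ n → ∀ a : ℕ → Fin 2, ∀ x ∈ gap b α a (n + 1),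
      |D x - 2| < ε n) : IsBowenMap b α (bowenMap b D) where
  gap_piece a n := (hD.isExpandingPiece_gap hα a n).1
  deriv_near_two := by
    obtain ⟨ε, h1, h2⟩ := hε
    refine ⟨ε, h1, fun n hn a x hx => ?_⟩
    rw [(hD.isExpandingPiece_gap hα a n).2 x hx]
    exact h2 n hn a x hx
  continuousOn_left := by
    refine (continuous_primitive hD.continuous).continuousOn.congr fun x hx => ?_
    rw [bowenMap, if_pos hx.2]
  continuousOn_right := by
    refine ((continuous_primitive hD.continuous).sub (continuous_const (y := 4 * digit 1))).continuousOn.congr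
      fun x hx => ?_
    exact hα.bowenMap_of_mem_firstAtom (i := 1) (by simpa [firstAtom] using hx)
  central_piece := by
    have h1 := hD.tendsto_left 0 0
    have h2 := hD.tendsto_right 0 0
    rw [gapLeft_zero] at h1
    rw [gapRight_zero] at h2
    exact (isExpandingPiece_of_primitive hD.toIsGapDensity (by linarith [hα.b_pos])
      (fun _ hx => bowenMap_of_mem_central hx) (hD.image_central hα) h1 h2).1

end Branches

/-! ### Existence: an explicit density with prescribed means on the gaps. -/

/-- A function on `[-1, 1]` that is greater than `1` inside, is equal to `2` at the ends, and has
mean `1 + 1 / (2 * m + 1) + c`. -/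
noncomputable def profile (m : ℕ) (c v : ℝ) : ℝ := 1 + v ^ (2 * m) + 3 * c / 2 * (1 - v ^ 2)

/-- The odd primitive of `profile`. -/
noncomputable def profilePrimitive (m : ℕ) (c v : ℝ) : ℝ :=
  v + v ^ (2 * m + 1) / (2 * m + 1) + 3 * c / 2 * (v - v ^ 3 / 3)

lemma profile_one (m : ℕ) (c : ℝ) : profile m c 1 = 2 := by simp [profile]; norm_num

lemma profile_neg_one (m : ℕ) (c : ℝ) : profile m c (-1) = 2 := by simp [profile]; norm_num

lemma continuous_profile (m : ℕ) (c : ℝ) : Continuous (profile m c) := by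
  unfold profile; fun_prop

lemma one_lt_profile {m : ℕ} {c v : ℝ} (hc : 0 < c) (hv : v ∈ Ioo (-1 : ℝ) 1) :
    1 < profile m c v := by
  have h1 : 0 ≤ v ^ (2 * m) := by rw [pow_mul]; positivity
  have h2 : 0 < 1 - v ^ 2 := by nlinarith [hv.1, hv.2]
  have h3 : 0 < 3 * c / 2 * (1 - v ^ 2) := by positivity
  rw [profile]; linarith

lemma abs_profile_zero_sub_two_le {c v : ℝ} (hc : 0 < c) (hv : v ∈ Ioo (-1 : ℝ) 1) :
    |profile 0 c v - 2| ≤ 3 * c / 2 := by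
  have h2 : 0 < 1 - v ^ 2 := by nlinarith [hv.1, hv.2]
  have h3 : 1 - v ^ 2 ≤ 1 := by nlinarith [sq_nonneg v]
  have h4 : profile 0 c v - 2 = 3 * c / 2 * (1 - v ^ 2) := by simp [profile]; ring
  rw [h4, abs_of_pos (by positivity)]
  exact mul_le_of_le_one_right (by positivity) h3

lemma hasDerivAt_profilePrimitive (m : ℕ) (c v : ℝ) :
    HasDerivAt (profilePrimitive m c) (profile m c v) v := by
  have h1 := ((hasDerivAt_id v).pow (2 * m + 1)).div_const (2 * (m : ℝ) + 1)
  have h2 := (((hasDerivAt_id v).sub (((hasDerivAt_id v).pow 3).div_const 3)).const_mul (3 * c / 2))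
  have h3 := ((hasDerivAt_id v).add h1).add h2
  convert! h3 using 1
  have : (2 * (m : ℝ) + 1) ≠ 0 := by positivity
  simp [profile]
  field_simp

lemma integral_profile (m : ℕ) (c z : ℝ) {h : ℝ} (hh : 0 < h) :
    ∫ x in (z - h)..(z + h), profile m c ((x - z) / h) =
      2 * h * (1 + 1 / (2 * m + 1) + c) := by
  have hd : ∀ x, HasDerivAt (fun x => h * profilePrimitive m c ((x - z) / h))
      (profile m c ((x - z) / h)) x := fun x => by
    have h1 := ((hasDerivAt_profilePrimitive m c ((x - z) / h)).comp x
      (((hasDerivAt_id x).sub_const z).div_const h)).const_mul h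
    convert! h1 using 1
    field_simp
  rw [intervalIntegral.integral_eq_sub_of_hasDerivAt (fun x _ => hd x)
    (Continuous.intervalIntegrable ((continuous_profile m c).comp (by fun_prop)) _ _)]
  have e1 : (z + h - z) / h = 1 := by field_simp; ring
  have e2 : (z - h - z) / h = -1 := by field_simp; ring
  have : (2 * (m : ℝ) + 1) ≠ 0 := by positivity
  rw [e1, e2]
  simp only [profilePrimitive, (show Odd (2 * m + 1) from ⟨m, rfl⟩).neg_one_pow]
  field_simp
  ring

open Classical in
/-- The density that is given on the gaps of generation `n` by the rescaled function
`profile (M n) (C n)` and is equal to `2` off the gaps. -/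
noncomputable def profileDensity (b : ℝ) (α : ℕ → ℝ) (M : ℕ → ℕ) (C : ℕ → ℝ) (x : ℝ) : ℝ :=
  if h : ∃ y : (ℕ → Fin 2) × ℕ, x ∈ gap b α y.1 y.2 then
    profile (M h.choose.2) (C h.choose.2)
      ((x - (gapLeft b α h.choose.1 h.choose.2 + gapLength b α h.choose.2 / 2)) /
        (gapLength b α h.choose.2 / 2))
  else 2

section Existence

variable {b : ℝ} {α : ℕ → ℝ} (hα : IsBowenData b α) {M : ℕ → ℕ} {C : ℕ → ℝ}

include hα

lemma IsBowenData.profileDensity_of_mem_gap {a : ℕ → Fin 2} {n : ℕ} {x : ℝ}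
    (hx : x ∈ gap b α a n) : profileDensity b α M C x = profile (M n) (C n)
      ((x - (gapLeft b α a n + gapLength b α n / 2)) / (gapLength b α n / 2)) := by
  have h : ∃ y : (ℕ → Fin 2) × ℕ, x ∈ gap b α y.1 y.2 := ⟨(a, n), hx⟩
  rw [profileDensity, dif_pos h]
  obtain ⟨e1, e2⟩ := hα.eq_of_mem_gap hx h.choose_spec
  rw [← e1, gapLeft_congr e2]

lemma IsBowenData.rescale_mem {a : ℕ → Fin 2} {n : ℕ} {x : ℝ} (hx : x ∈ gap b α a n) :
    (x - (gapLeft b α a n + gapLength b α n / 2)) / (gapLength b α n / 2) ∈ Ioo (-1 : ℝ) 1 := by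
  have hl := hα.gapLength_pos n
  rw [gap, gapRight_eq_gapLeft_add] at hx
  constructor
  · rw [lt_div_iff₀ (by positivity)]; linarith [hx.1]
  · rw [div_lt_iff₀ (by positivity)]; linarith [hx.2]

lemma IsBowenData.isGapDensity_profileDensity (hC : ∀ n, 0 < C n) (hM : ∀ n, 1 ≤ n → M n = 0)
    (hC0 : Tendsto C atTop (𝓝 0)) : IsGapDensity b α (profileDensity b α M C) where
  eq_two x hx := by
    rw [profileDensity, dif_neg]
    rintro ⟨y, hy⟩
    exact hx _ _ hy
  one_lt_of_mem a n x hx := by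
    rw [hα.profileDensity_of_mem_gap hx]
    exact one_lt_profile (hC n) (hα.rescale_mem hx)
  continuousOn_gap a n := by
    refine ContinuousOn.congr (Continuous.continuousOn ?_)
      fun x hx => hα.profileDensity_of_mem_gap hx
    exact (continuous_profile _ _).comp (by fun_prop)
  tendsto_left a n := by
    have hl := hα.gapLength_pos n
    have h1 : Continuous fun x => profile (M n) (C n)
        ((x - (gapLeft b α a n + gapLength b α n / 2)) / (gapLength b α n / 2)) :=
      (continuous_profile _ _).comp (by fun_prop)
    have h2 := (h1.tendsto (gapLeft b α a n)).mono_left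
      (nhdsWithin_le_nhds (s := Ioi (gapLeft b α a n)))
    have e : (gapLeft b α a n - (gapLeft b α a n + gapLength b α n / 2)) / (gapLength b α n / 2) =
        -1 := by field_simp; ring
    rw [e, profile_neg_one] at h2
    refine h2.congr' ?_
    filter_upwards [Ioo_mem_nhdsGT (hα.gapLeft_lt_gapRight (a := a) (n := n))] with x hx
    exact (hα.profileDensity_of_mem_gap hx).symm
  tendsto_right a n := by
    have hl := hα.gapLength_pos n
    have h1 : Continuous fun x => profile (M n) (C n)
        ((x - (gapLeft b α a n + gapLength b α n / 2)) / (gapLength b α n / 2)) :=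
      (continuous_profile _ _).comp (by fun_prop)
    have h2 := (h1.tendsto (gapRight b α a n)).mono_left
      (nhdsWithin_le_nhds (s := Iio (gapRight b α a n)))
    have e : (gapRight b α a n - (gapLeft b α a n + gapLength b α n / 2)) / (gapLength b α n / 2) =
        1 := by rw [gapRight_eq_gapLeft_add]; field_simp; ring
    rw [e, profile_one] at h2
    refine h2.congr' ?_
    filter_upwards [Ioo_mem_nhdsLT (hα.gapLeft_lt_gapRight (a := a) (n := n))] with x hx
    exact (hα.profileDensity_of_mem_gap hx).symm
  near_two η hη := by
    obtain ⟨N, hN⟩ := eventually_atTop.1 (hC0.eventually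
      (Iio_mem_nhds (show 0 < η / 2 by linarith)))
    refine ⟨max N 1, fun n hn a x hx => ?_⟩
    rw [hα.profileDensity_of_mem_gap hx, hM n (by omega)]
    have h1 : C n < η / 2 := hN n (by omega)
    have h2 := abs_profile_zero_sub_two_le (hC n) (hα.rescale_mem hx)
    linarith

lemma IsBowenData.integral_profileDensity (a : ℕ → Fin 2) (n : ℕ) :
    ∫ t in (gapLeft b α a n)..(gapRight b α a n), profileDensity b α M C t =
      gapLength b α n * (1 + 1 / (2 * M n + 1) + C n) := by
  have hl := hα.gapLength_pos n
  have h1 := integral_profile (M n) (C n) (gapLeft b α a n + gapLength b α n / 2)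
    (h := gapLength b α n / 2) (by positivity)
  rw [add_sub_cancel_right, add_assoc, add_halves, ← gapRight_eq_gapLeft_add] at h1
  rw [show gapLength b α n * (1 + 1 / (2 * M n + 1) + C n) =
    2 * (gapLength b α n / 2) * (1 + 1 / (2 * M n + 1) + C n) by ring, ← h1]
  refine intervalIntegral.integral_congr_Ioo_of_le hα.gapLeft_lt_gapRight.le fun x hx => ?_
  exact hα.profileDensity_of_mem_gap hx

lemma IsBowenData.gapTotal_succ_lt (n : ℕ) : gapTotal b α (n + 1) < gapTotal b α n := by
  cases n with
  | zero => rw [gapTotal_succ, gapTotal_zero]; exact hα.first_lt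
  | succ n => rw [gapTotal_succ, gapTotal_succ]; exact hα.strictAnti _ (by omega)

lemma IsBowenData.tendsto_gapTotal_ratio :
    Tendsto (fun n => gapTotal b α n / gapTotal b α (n + 1)) atTop (𝓝 1) := by
  have h := hα.tendsto_ratio.inv₀ one_ne_zero
  rw [inv_one] at h
  refine h.congr' (eventually_atTop.2 ⟨1, fun n hn => ?_⟩)
  obtain ⟨k, rfl⟩ := Nat.exists_eq_add_of_le' hn
  simp only [gapTotal_succ, inv_div]

theorem IsBowenData.exists_isBowenMap : ∃ f, IsBowenMap b α f := by
  have hb := hα.b_pos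
  have hb1 : 0 < 1 / b - 1 := by rw [sub_pos, lt_div_iff₀ hb]; linarith [hα.b_lt_one]
  -- The central gap must have mean `2 / (2 * b) = 1 / b`, which exceeds `1` but may be below `2`. A
  -- high power `v ^ (2 * m)` keeps the boundary value `2` while contributing only `1 / (2 * m + 1)`
  -- to the mean.
  obtain ⟨m, hm⟩ := exists_nat_one_div_lt hb1
  have hm' : 1 / (2 * (m : ℝ) + 1) < 1 / b - 1 := by
    refine lt_of_le_of_lt ?_ hm
    gcongr
    linarith [(Nat.cast_nonneg m : (0 : ℝ) ≤ m)]
  let M : ℕ → ℕ := fun n => if n = 0 then m else 0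
  -- For generation `k + 1` the exponent is `0` and the mean is `2 + C (k + 1)`; it must equal
  -- `gapLength b α k / gapLength b α (k + 1)`, which is `2 * gapTotal b α k / gapTotal b α (k +
  -- 1)`. For `k = 0` positivity comes from `α 1 < 2 * b`.
  let C : ℕ → ℝ := fun n => n.casesOn (1 / b - 1 - 1 / (2 * (m : ℝ) + 1))
    fun k => 2 * (gapTotal b α k / gapTotal b α (k + 1) - 1)
  have hC : ∀ n, 0 < C n := by
    rintro (_ | k)
    · exact sub_pos.2 hm'
    · have : 1 < gapTotal b α k / gapTotal b α (k + 1) :=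
        (one_lt_div (hα.gapTotal_pos _)).2 (hα.gapTotal_succ_lt k)
      change 0 < 2 * (gapTotal b α k / gapTotal b α (k + 1) - 1)
      linarith
  have hM : ∀ n, 1 ≤ n → M n = 0 := fun n hn => if_neg (by omega)
  have hC1 : Tendsto (fun n => C (n + 1)) atTop (𝓝 0) := by
    have := (hα.tendsto_gapTotal_ratio.sub_const 1).const_mul 2
    simpa using this
  have hC0 : Tendsto C atTop (𝓝 0) := (tendsto_add_atTop_iff_nat 1).1 hC1
  have hD : IsBowenDensity b α (profileDensity b α M C) :=
    { hα.isGapDensity_profileDensity hC hM hC0 with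
      integral_central := by
        have h := hα.integral_profileDensity (M := M) (C := C) 0 0
        rw [gapLeft_zero, gapRight_zero] at h
        rw [h]
        simp [gapLength, M, C]
        field_simp
      integral_gap := fun a n => by
        rw [hα.integral_profileDensity, hM _ (by omega)]
        have h0 := (hα.gapTotal_pos (n + 1)).ne'
        simp only [gapLength_eq, C]
        field_simp
        push_cast
        ring }
  refine ⟨_, hD.isBowenMap hα ⟨fun n => 3 * C (n + 1), by simpa using hC1.const_mul 3,
    fun n _ a x hx => ?_⟩⟩
  rw [hα.profileDensity_of_mem_gap hx, hM (n + 1) (by omega)]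
  have := abs_profile_zero_sub_two_le (hC (n + 1)) (hα.rescale_mem hx)
  linarith [hC (n + 1)]

end Existence

/-! ### Every Bowen map comes from its density; dynamics on `K`. -/

/-- An expanding piece is a translate of a primitive of its derivative. -/
lemma IsExpandingPiece.eq_primitive {f D : ℝ → ℝ} {p q p' q' : ℝ}
    (hf : IsExpandingPiece f p q p' q') (hpq : p < q) (hc : Continuous D) (h1 : ∀ x, 1 < D x)
    (hD : ∀ x ∈ Ioo p q, D x = deriv f x) :
    (∀ x ∈ Ioo p q, f x = primitive D x - primitive D p + p') ∧
      ∫ t in p..q, D t = q' - p' := by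
  have hmono : StrictMono (primitive D) :=
    strictMono_primitive hc fun x => zero_lt_one.trans (h1 x)
  obtain ⟨c, hcst⟩ : ∃ c, ∀ x ∈ Ioo p q, f x - primitive D x = c := by
    have hdiff : ∀ x ∈ Ioo p q, HasDerivAt (fun x => f x - primitive D x) 0 x := fun x hx => by
      have h2 := ((hf.contDiffOn.differentiableOn one_ne_zero).differentiableAt
        (isOpen_Ioo.mem_nhds hx)).hasDerivAt.sub (hasDerivAt_primitive hc x)
      rwa [hD x hx, sub_self] at h2
    exact isOpen_Ioo.exists_is_const_of_deriv_eq_zero isPreconnected_Ioo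
      (fun x hx => (hdiff x hx).differentiableAt.differentiableWithinAt)
      fun x hx => (hdiff x hx).deriv
  -- Comparing the infima and suprema of the two descriptions of the image identifies the constant
  -- `c` and the integral.
  have himg : Ioo p' q' = Ioo (primitive D p + c) (primitive D q + c) := by
    rw [← hf.image_eq, ← image_add_const_Ioo,
      ← StrictMono.image_Ioo_eq hmono (continuous_primitive hc) hpq, image_image]
    exact image_congr fun x hx => by linarith [hcst x hx]
  have hne : primitive D p + c < primitive D q + c := by linarith [hmono hpq]
  have hne' : p' < q' := by
    rw [← nonempty_Ioo, himg]; exact nonempty_Ioo.2 hne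
  have e1 : p' = primitive D p + c := by rw [← csInf_Ioo hne', himg, csInf_Ioo hne]
  have e2 : q' = primitive D q + c := by rw [← csSup_Ioo hne', himg, csSup_Ioo hne]
  refine ⟨fun x hx => by linarith [hcst x hx], ?_⟩
  rw [← primitive_sub hc]; linarith

open Classical in
/-- The derivative of `f` on the gaps, extended by `2`. -/
noncomputable def gapDeriv (b : ℝ) (α : ℕ → ℝ) (f : ℝ → ℝ) (x : ℝ) : ℝ :=
  if ∃ a n, x ∈ gap b α a n then deriv f x else 2

section BowenMap

variable {b : ℝ} {α : ℕ → ℝ} {f : ℝ → ℝ} {a : ℕ → Fin 2} {n : ℕ} {x : ℝ}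

lemma gapDeriv_of_mem (hx : x ∈ gap b α a n) : gapDeriv b α f x = deriv f x :=
  if_pos ⟨a, n, hx⟩

lemma IsBowenMap.exists_isExpandingPiece (hf : IsBowenMap b α f) (a : ℕ → Fin 2) (n : ℕ) :
    ∃ p' q', IsExpandingPiece f (gapLeft b α a n) (gapRight b α a n) p' q' := by
  cases n with
  | zero =>
    rw [gapLeft_zero, gapRight_zero]
    exact ⟨_, _, hf.central_piece⟩
  | succ n => exact ⟨_, _, hf.gap_piece a n⟩

variable (hα : IsBowenData b α) (hf : IsBowenMap b α f)

include hα hf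

lemma IsBowenMap.isGapDensity : IsGapDensity b α (gapDeriv b α f) where
  eq_two x hx := if_neg (by push Not; exact hx)
  one_lt_of_mem a n x hx := by
    obtain ⟨p', q', h⟩ := hf.exists_isExpandingPiece a n
    rw [gapDeriv_of_mem hx]
    exact h.one_lt_deriv x hx
  continuousOn_gap a n := by
    obtain ⟨p', q', h⟩ := hf.exists_isExpandingPiece a n
    exact (h.contDiffOn.continuousOn_deriv_of_isOpen isOpen_gap le_rfl).congr
      fun x hx => gapDeriv_of_mem hx
  tendsto_left a n := by
    obtain ⟨p', q', h⟩ := hf.exists_isExpandingPiece a n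
    refine h.tendsto_left.congr' ?_
    filter_upwards [Ioo_mem_nhdsGT (hα.gapLeft_lt_gapRight (a := a) (n := n))] with x hx
    exact (gapDeriv_of_mem hx).symm
  tendsto_right a n := by
    obtain ⟨p', q', h⟩ := hf.exists_isExpandingPiece a n
    refine h.tendsto_right.congr' ?_
    filter_upwards [Ioo_mem_nhdsLT (hα.gapLeft_lt_gapRight (a := a) (n := n))] with x hx
    exact (gapDeriv_of_mem hx).symm
  near_two η hη := by
    obtain ⟨ε, h0, hε⟩ := hf.deriv_near_two
    obtain ⟨N, hN⟩ := eventually_atTop.1 (h0.eventually (Iio_mem_nhds hη))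
    -- The bound `ε k` concerns generation `k + 1` and is given only for `k ≥ 1`.
    refine ⟨N + 2, fun n hn a x hx => ?_⟩
    obtain ⟨k, rfl⟩ := Nat.exists_eq_add_of_le' (show 1 ≤ n by omega)
    rw [gapDeriv_of_mem hx]
    exact (hε k (by omega) a x hx).trans (hN k (by omega))

lemma IsBowenMap.eq_primitive_of_mem_gap (a : ℕ → Fin 2) (n : ℕ) :
    (∀ x ∈ gap b α a (n + 1), f x = primitive (gapDeriv b α f) x -
      primitive (gapDeriv b α f) (gapLeft b α a (n + 1)) + gapLeft b α (shift a) n) ∧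
    ∫ t in (gapLeft b α a (n + 1))..(gapRight b α a (n + 1)), gapDeriv b α f t =
      gapLength b α n := by
  have hD := hf.isGapDensity hα
  have h := (hf.gap_piece a n).eq_primitive hα.gapLeft_lt_gapRight hD.continuous hD.one_lt
    fun x hx => gapDeriv_of_mem hx
  rwa [gapRight_eq_gapLeft_add (n := n), add_sub_cancel_left] at h

lemma IsBowenMap.eq_primitive_of_mem_central :
    (∀ x ∈ Ioo (-b) b, f x = primitive (gapDeriv b α f) x -
      primitive (gapDeriv b α f) (-b) + -1) ∧ ∫ t in (-b)..b, gapDeriv b α f t = 2 := by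
  have hD := hf.isGapDensity hα
  have h := hf.central_piece.eq_primitive (by linarith [hα.b_pos]) hD.continuous hD.one_lt
    fun x hx => gapDeriv_of_mem (by rwa [gap_zero (a := 0)])
  norm_num at h ⊢
  exact h

lemma IsBowenMap.isBowenDensity : IsBowenDensity b α (gapDeriv b α f) :=
  { hf.isGapDensity hα with
    integral_central := (hf.eq_primitive_of_mem_central hα).2
    integral_gap := fun a n => (hf.eq_primitive_of_mem_gap hα a n).2 }

lemma IsBowenMap.eq_bowenMap_of_mem_gap (hx : x ∈ gap b α a n) :
    f x = bowenMap b (gapDeriv b α f) x := by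
  have hD := hf.isBowenDensity hα
  cases n with
  | zero =>
    rw [gap_zero] at hx
    rw [bowenMap_of_mem_central hx, (hf.eq_primitive_of_mem_central hα).1 x hx,
      hD.primitive_neg_b hα]
    ring
  | succ n =>
    rw [hα.bowenMap_of_mem_firstAtom (hα.gap_succ_subset_firstAtom hx),
      (hf.eq_primitive_of_mem_gap hα a n).1 x hx, hD.primitive_gapLeft hα]
    ring

omit hα in
lemma IsBowenMap.continuousOn_firstAtom (i : Fin 2) : ContinuousOn f (firstAtom b i) := by
  rcases eq_zero_or_eq_one i with rfl | rfl
  · simpa [firstAtom] using hf.continuousOn_left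
  · simpa [firstAtom] using hf.continuousOn_right

lemma IsBowenMap.eq_bowenMap (hx : x ∈ Icc (-1 : ℝ) 1) :
    f x = bowenMap b (gapDeriv b α f) x := by
  by_cases h : ∀ a n, x ∉ gap b α a n
  · have hxK := mem_cantorSet_of_notMem_gap hx h
    rw [← hα.range_point] at hxK
    obtain ⟨a, rfl⟩ := hxK
    have hD := hf.isBowenDensity hα
    -- A point of `K` is a limit of midpoints of gaps. Starting with generation `1` keeps these
    -- midpoints in the same first atom, where both maps are continuous.
    have hmem : ∀ n, (gapLeft b α a (n + 1) + gapRight b α a (n + 1)) / 2 ∈ gap b α a (n + 1) :=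
      fun n => by
        have := hα.gapLeft_lt_gapRight (a := a) (n := n + 1)
        constructor <;> linarith
    have hlim : Tendsto (fun n => (gapLeft b α a (n + 1) + gapRight b α a (n + 1)) / 2) atTop
        (𝓝[firstAtom b (a 0)] (point b α a)) := by
      refine tendsto_nhdsWithin_iff.2 ⟨?_, Eventually.of_forall fun n =>
        hα.gap_succ_subset_firstAtom (hmem n)⟩
      have h1 := (hα.tendsto_atomLeft a).comp (tendsto_add_atTop_nat 1)
      have h2 := hα.tendsto_atomLength.comp (tendsto_add_atTop_nat 1)
      have h3 := h1.add h2
      rw [add_zero] at h3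
      refine tendsto_of_tendsto_of_tendsto_of_le_of_le h1 h3 (fun n => ?_) fun n => ?_
      · exact (mem_atom.1 (hα.gap_subset_atom (hmem n))).1
      · exact (mem_atom.1 (hα.gap_subset_atom (hmem n))).2
    have hp : point b α a ∈ firstAtom b (a 0) :=
      hα.atom_succ_subset_firstAtom (n := 0) hα.point_mem_atom
    have hg : ContinuousOn (bowenMap b (gapDeriv b α f)) (firstAtom b (a 0)) :=
      ((continuous_primitive hD.continuous).sub
        (continuous_const (y := 4 * digit (a 0)))).continuousOn.congr
          fun x hx => hα.bowenMap_of_mem_firstAtom hx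
    refine tendsto_nhds_unique ((hf.continuousOn_firstAtom _ _ hp).tendsto.comp hlim) ?_
    refine ((hg _ hp).tendsto.comp hlim).congr fun n => ?_
    exact (hf.eq_bowenMap_of_mem_gap hα (hmem n)).symm
  · push Not at h
    obtain ⟨a, n, h⟩ := h
    exact hf.eq_bowenMap_of_mem_gap hα h

lemma IsBowenMap.mapsTo_Icc : MapsTo f (Icc (-1) 1) (Icc (-1) 1) := fun x hx => by
  rw [hf.eq_bowenMap hα hx]
  exact (hf.isBowenDensity hα).mapsTo_Icc hα hx

lemma IsBowenMap.apply_point (a : ℕ → Fin 2) : f (point b α a) = point b α (shift a) := by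
  rw [hf.eq_bowenMap hα (hα.cantorSet_subset_Icc hα.point_mem_cantorSet)]
  exact (hf.isBowenDensity hα).bowenMap_point hα

lemma IsBowenMap.mapsTo_cantorSet : MapsTo f (cantorSet b α) (cantorSet b α) := by
  rw [← hα.range_point]
  rintro _ ⟨a, rfl⟩
  exact ⟨shift a, (hf.apply_point hα a).symm⟩

lemma IsBowenMap.iterate_point_mem_firstAtom (a : ℕ → Fin 2) (n : ℕ) :
    f^[n] (point b α a) ∈ firstAtom b (a n) := by
  induction n generalizing a with
  | zero => exact hα.atom_succ_subset_firstAtom (n := 0) hα.point_mem_atom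
  | succ n ih =>
    rw [Function.iterate_succ_apply, hf.apply_point hα]
    exact ih (shift a)

omit hα in
lemma IsBowenMap.iterate_mem_gap_zero (hx : x ∈ gap b α a n) : f^[n] x ∈ Ioo (-b) b := by
  induction n generalizing a x with
  | zero => rwa [gap_zero] at hx
  | succ n ih =>
    rw [Function.iterate_succ_apply]
    refine ih (a := shift a) ?_
    rw [gap, ← (hf.gap_piece a n).image_eq]
    exact mem_image_of_mem f hx

/-- A point of `K` never leaves the first atoms because its orbit follows the shift. A point of
`[-1, 1]` outside `K` lies in a gap, and a gap of generation `n` enters the central gap after `n`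
steps. -/
lemma IsBowenMap.cantorSet_eq :
    cantorSet b α = {x | ∀ n : ℕ, f^[n] x ∈ firstAtom b 0 ∪ firstAtom b 1} := by
  have hb := hα.b_lt_one
  have hb' := hα.b_pos
  ext x
  constructor
  · intro hx n
    rw [← hα.range_point] at hx
    obtain ⟨a, rfl⟩ := hx
    have h := hf.iterate_point_mem_firstAtom hα a n
    rcases eq_zero_or_eq_one (a n) with h0 | h0 <;> rw [h0] at h
    · exact Or.inl h
    · exact Or.inr h
  · intro hx
    simp only [firstAtom, mem_ofPred_eq, if_true, one_ne_zero, if_false] at hx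
    refine mem_cantorSet_of_notMem_gap ?_ fun a n h => ?_
    · rcases (show x ∈ Icc (-1) (-b) ∪ Icc b 1 from hx 0) with h | h
      · exact ⟨h.1, by linarith [h.2]⟩
      · exact ⟨by linarith [h.1], h.2⟩
    · have h1 := hf.iterate_mem_gap_zero h
      rcases hx n with h | h
      · exact absurd h.2 (not_le.2 h1.1)
      · exact absurd h.1 (not_le.2 h1.2)

end BowenMap

/-! ### The induced circle map and its `C¹` lift. -/

lemma circle_coe_eq_iff {x y : ℝ} : (x : Circle2) = y ↔ ∃ k : ℤ, x = y + k * 2 := by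
  rw [← sub_eq_zero, ← AddCircle.coe_sub, AddCircle.coe_eq_zero_iff]
  refine exists_congr fun k => ?_
  rw [zsmul_eq_mul]
  constructor <;> intro h <;> linarith

/-- The periodic extension of a density from `[-1, 1)`. -/
noncomputable def periodicDensity (D : ℝ → ℝ) (x : ℝ) : ℝ :=
  AddCircle.liftIco (2 : ℝ) (-1) D (x : Circle2)

lemma periodic_periodicDensity (D : ℝ → ℝ) : Function.Periodic (periodicDensity D) 2 := fun x => by
  simp only [periodicDensity, AddCircle.coe_add_period]

lemma IsC1Lift.continuous {F : Circle2 → Circle2} {φ : ℝ → ℝ} (h : IsC1Lift F φ) :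
    Continuous F := by
  rw [(QuotientAddGroup.isQuotientMap_mk (N := AddSubgroup.zmultiples (2 : ℝ))).continuous_iff]
  have e : F ∘ (fun x : ℝ => (x : Circle2)) = fun x : ℝ => ((φ x : ℝ) : Circle2) := funext h.2
  exact e ▸ (AddCircle.continuous_mk' 2).comp h.1.continuous

/-- Two lifts of a circle map have the same derivative. -/
lemma IsC1Lift.deriv_eq {F : Circle2 → Circle2} {φ ψ : ℝ → ℝ} (hφ : IsC1Lift F φ)
    (hψ : IsC1Lift F ψ) : deriv φ = deriv ψ := by
  ext x
  have hk : ∀ y, ∃ k : ℤ, φ y = ψ y + k * 2 := fun y =>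
    circle_coe_eq_iff.1 ((hφ.2 y).symm.trans (hψ.2 y))
  obtain ⟨k, hkx⟩ := hk x
  have hc : Continuous fun y => φ y - ψ y := hφ.1.continuous.sub hψ.1.continuous
  -- The difference of the lifts is continuous with values in the even integers, hence locally
  -- constant.
  have hev : φ =ᶠ[𝓝 x] fun y => ψ y + k * 2 := by
    filter_upwards [hc.continuousAt.eventually (Metric.ball_mem_nhds (φ x - ψ x) two_pos)] with y hy
    obtain ⟨j, hj⟩ := hk y
    rw [Real.dist_eq, hj, hkx, add_sub_cancel_left, add_sub_cancel_left, ← sub_mul, abs_mul,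
      abs_two] at hy
    have h1 : |((j - k : ℤ) : ℝ)| < 1 := by push_cast; linarith
    rw [← Int.cast_abs] at h1
    have h2 : j - k = 0 := Int.abs_lt_one_iff.1 (by exact_mod_cast h1)
    rw [hj, sub_eq_zero.1 h2]
  rw [hev.deriv_eq, deriv_add_const]

section Lift

variable {b : ℝ} {α : ℕ → ℝ} {D : ℝ → ℝ} {x : ℝ}

/-- The branch constants `0`, `2`, `4` are multiples of the period. -/
lemma coe_bowenMap (b : ℝ) (D : ℝ → ℝ) (x : ℝ) :
    ((bowenMap b D x : ℝ) : Circle2) = (primitive D x : ℝ) := by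
  rw [circle_coe_eq_iff, bowenMap]
  split_ifs
  · exact ⟨0, by simp⟩
  · exact ⟨-1, by push_cast; ring⟩
  · exact ⟨-2, by push_cast; ring⟩

variable (hα : IsBowenData b α)

include hα

lemma IsBowenData.gap_subset_Ioo {a : ℕ → Fin 2} {n : ℕ} : gap b α a n ⊆ Ioo (-1) 1 := by
  intro x hx
  rw [mem_gap] at hx
  have h1 : atomLeft b α a n ∈ atom b α a n := hα.atomLeft_mem_atom le_rfl
  have h2 : atomLeft b α a n + atomLength b α n ∈ atom b α a n :=
    mem_atom.2 ⟨by linarith [hα.atomLength_pos n], le_rfl⟩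
  have h3 := hα.atomLength_pos (n + 1)
  have h4 := atomLength_eq_add_step (b := b) (α := α) (n := n)
  have h5 := hα.atom_subset_Icc h1
  have h6 := hα.atom_subset_Icc h2
  constructor <;> linarith [h5.1, h6.2]

lemma IsGapDensity.apply_one (hD : IsGapDensity b α D) : D 1 = 2 :=
  hD.eq_two _ fun _ _ h => lt_irrefl _ (hα.gap_subset_Ioo h).2

lemma IsGapDensity.apply_neg_one (hD : IsGapDensity b α D) : D (-1) = 2 :=
  hD.eq_two _ fun _ _ h => lt_irrefl _ (hα.gap_subset_Ioo h).1

lemma IsGapDensity.periodicDensity_eq (hD : IsGapDensity b α D) (hx : x ∈ Icc (-1 : ℝ) 1) :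
    periodicDensity D x = D x := by
  rcases hx.2.lt_or_eq with h | rfl
  · exact AddCircle.liftIco_coe_apply ⟨hx.1, by linarith⟩
  · have h := periodic_periodicDensity D (-1)
    norm_num at h
    rw [h, hD.apply_one hα, ← hD.apply_neg_one hα]
    exact AddCircle.liftIco_coe_apply (by norm_num)

lemma IsGapDensity.continuous_periodicDensity (hD : IsGapDensity b α D) :
    Continuous (periodicDensity D) := by
  refine (AddCircle.liftIco_continuous (p := (2 : ℝ)) ?_ hD.continuous.continuousOn).comp
    (AddCircle.continuous_mk' 2)
  norm_num [hD.apply_one hα, hD.apply_neg_one hα]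

lemma IsGapDensity.primitive_periodicDensity_eq (hD : IsGapDensity b α D)
    (hx : x ∈ Icc (-1 : ℝ) 1) : primitive (periodicDensity D) x = primitive D x := by
  unfold primitive
  congr 1
  refine intervalIntegral.integral_congr fun t ht => hD.periodicDensity_eq hα ?_
  rw [uIcc_of_le hx.1] at ht
  exact ⟨ht.1, ht.2.trans hx.2⟩

/-- Over one period the primitive goes from `-1` to `5`: the increment `6` is three turns, one for
each full branch. -/
lemma IsBowenDensity.primitive_periodicDensity_add (hD : IsBowenDensity b α D) (x : ℝ) (k : ℤ) :
    primitive (periodicDensity D) (x + k * 2) = primitive (periodicDensity D) x + k * 6 := by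
  have hc := hD.continuous_periodicDensity hα
  have h := (periodic_periodicDensity D).intervalIntegral_add_zsmul_eq k x
    fun _ _ => hc.intervalIntegrable _ _
  have h2 := (periodic_periodicDensity D).intervalIntegral_add_eq x (-1)
  rw [h2, ← primitive_sub hc, ← primitive_sub hc, show (-1 : ℝ) + 2 = 1 by norm_num,
    hD.primitive_periodicDensity_eq hα (x := 1) (by norm_num),
    hD.primitive_periodicDensity_eq hα (x := -1) (by norm_num), hD.primitive_one hα, primitive_neg_one, zsmul_eq_mul, zsmul_eq_mul] at h
  linarith

end Lift

section CircleMap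

variable {b : ℝ} {α : ℕ → ℝ} {f : ℝ → ℝ} (hα : IsBowenData b α) (hf : IsBowenMap b α f)

include hα hf

lemma IsBowenMap.isC1Lift :
    IsC1Lift (circleMap f) (primitive (periodicDensity (gapDeriv b α f))) := by
  have hD := hf.isBowenDensity hα
  have hc := hD.continuous_periodicDensity hα
  refine ⟨?_, fun x => ?_⟩
  · rw [contDiff_one_iff_deriv]
    refine ⟨fun x => (hasDerivAt_primitive hc x).differentiableAt, ?_⟩
    rwa [show deriv (primitive (periodicDensity (gapDeriv b α f))) = _ from
      funext fun x => (hasDerivAt_primitive hc x).deriv]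
  · obtain ⟨y, hy, k, rfl⟩ : ∃ y ∈ Ico (-1 : ℝ) (-1 + 2), ∃ k : ℤ, x = y + k * 2 :=
      ⟨toIcoMod two_pos (-1) x, toIcoMod_mem_Ico _ _ _, toIcoDiv two_pos (-1) x, by
        rw [← zsmul_eq_mul, toIcoMod_add_toIcoDiv_zsmul]⟩
    have hy' : y ∈ Icc (-1 : ℝ) 1 := ⟨hy.1, by linarith [hy.2]⟩
    rw [circle_coe_eq_iff.2 ⟨k, rfl⟩, hD.primitive_periodicDensity_add hα, circleMap,
      AddCircle.liftIco_coe_apply hy, hf.eq_bowenMap hα hy', coe_bowenMap,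
      hD.primitive_periodicDensity_eq hα hy']
    exact (circle_coe_eq_iff.2 ⟨k * 3, by push_cast; ring⟩).symm

lemma IsBowenMap.deriv_lift (x : ℝ) :
    deriv (primitive (periodicDensity (gapDeriv b α f))) x = periodicDensity (gapDeriv b α f) x :=
  (hasDerivAt_primitive ((hf.isBowenDensity hα).continuous_periodicDensity hα) x).deriv

lemma IsBowenMap.circleMap_coe {x : ℝ} (hx : x ∈ Icc (-1 : ℝ) 1) :
    circleMap f (x : Circle2) = (f x : Circle2) := by
  rw [(hf.isC1Lift hα).2, (hf.isBowenDensity hα).primitive_periodicDensity_eq hα hx,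
    hf.eq_bowenMap hα hx, coe_bowenMap]

lemma IsBowenMap.isC1Expanding : IsC1Expanding (circleMap f) := by
  refine ⟨_, hf.isC1Lift hα, ?_⟩
  have hD := hf.isBowenDensity hα
  obtain ⟨x₀, -, hx₀⟩ := isCompact_Icc.exists_isMinOn (nonempty_Icc.2 (by norm_num : (-1 : ℝ) ≤ 1))
    hD.continuous.continuousOn
  refine ⟨_, hD.one_lt x₀, fun x => ?_⟩
  rw [hf.deriv_lift hα]
  refine le_trans ?_ (le_abs_self _)
  have e : periodicDensity (gapDeriv b α f) x =
      periodicDensity (gapDeriv b α f) (toIcoMod two_pos (-1) x) := by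
    conv_lhs => rw [← toIcoMod_add_toIcoDiv_zsmul (two_pos (α := ℝ)) (-1) x]
    exact (periodic_periodicDensity _).zsmul _ _
  have hy := toIcoMod_mem_Ico (two_pos (α := ℝ)) (-1) x
  have hy' : toIcoMod two_pos (-1) x ∈ Icc (-1 : ℝ) 1 := ⟨hy.1, by linarith [hy.2]⟩
  rw [e, hD.periodicDensity_eq hα hy']
  exact hx₀ hy'

end CircleMap

/-! ### Failure of Hölder continuity of the derivative. -/

section Holder

variable {b : ℝ} {α : ℕ → ℝ} {D : ℝ → ℝ} (hα : IsBowenData b α)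

include hα

/-- A density with an exact expansion of the gaps is somewhere equal to the mean expansion. -/
lemma IsBowenDensity.exists_eq_div (hD : IsBowenDensity b α D) (a : ℕ → Fin 2) (n : ℕ) :
    ∃ x ∈ gap b α a (n + 1), D x = gapLength b α n / gapLength b α (n + 1) := by
  obtain ⟨x, hx, h⟩ := exists_deriv_eq_slope (primitive D)
    (hα.gapLeft_lt_gapRight (a := a) (n := n + 1)) (continuous_primitive hD.continuous).continuousOn
    fun x _ => (hasDerivAt_primitive hD.continuous x).differentiableAt.differentiableWithinAt
  refine ⟨x, hx, ?_⟩
  rwa [(hasDerivAt_primitive hD.continuous x).deriv, primitive_sub hD.continuous, hD.integral_gap,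
    gapRight_eq_gapLeft_add (n := n + 1), add_sub_cancel_left] at h

omit hα in
lemma IsGapDensity.apply_gapLeft (hD : IsGapDensity b α D) (a : ℕ → Fin 2) (n : ℕ) :
    D (gapLeft b α a n) = 2 :=
  tendsto_nhds_unique (hD.continuous.continuousAt.tendsto.mono_left nhdsWithin_le_nhds)
    (hD.tendsto_left a n)

omit hα in
lemma circle_dist_le (x y : ℝ) : dist (x : Circle2) (y : Circle2) ≤ |x - y| := by
  rw [dist_eq_norm, ← AddCircle.coe_sub, ← Real.norm_eq_abs]
  exact QuotientAddGroup.norm_mk_le_norm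

/-- By `1 + x ≤ exp x` and the geometric series, such bounds would keep the product of the ratios
bounded; this product is `gapTotal b α 0 / gapTotal b α n`, which tends to infinity. -/
lemma IsBowenData.gapTotal_ratio_unbounded {C θ : ℝ} (hC : 0 ≤ C) (hθ : 0 ≤ θ) (hθ1 : θ < 1) :
    ¬ ∀ n, gapTotal b α n / gapTotal b α (n + 1) ≤ 1 + C * θ ^ n := by
  intro h
  have key : ∀ n, gapTotal b α 0 ≤
      gapTotal b α n * Real.exp (C * ∑ k ∈ Finset.range n, θ ^ k) := by
    intro n
    induction n with
    | zero => simp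
    | succ n ih =>
      have h1 : gapTotal b α n ≤ gapTotal b α (n + 1) * Real.exp (C * θ ^ n) := by
        have h2 := (h n).trans ((add_comm _ _).trans_le (Real.add_one_le_exp (C * θ ^ n)))
        rwa [div_le_iff₀ (hα.gapTotal_pos _), mul_comm] at h2
      rw [Finset.sum_range_succ, mul_add, Real.exp_add]
      nlinarith [Real.exp_pos (C * ∑ k ∈ Finset.range n, θ ^ k)]
  have h2 : ∀ n, gapTotal b α 0 ≤ gapTotal b α n * Real.exp (C * (1 - θ)⁻¹) := fun n => by
    refine (key n).trans (mul_le_mul_of_nonneg_left (Real.exp_le_exp.2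
      (mul_le_mul_of_nonneg_left ?_ hC)) (hα.gapTotal_pos n).le)
    rw [← tsum_geometric_of_lt_one hθ hθ1]
    exact (summable_geometric_of_lt_one hθ hθ1).sum_le_tsum _ fun i _ => pow_nonneg hθ i
  have h3 := ge_of_tendsto' (hα.tendsto_gapTotal.mul_const (Real.exp (C * (1 - θ)⁻¹))) h2
  rw [zero_mul] at h3
  exact absurd (hα.gapTotal_pos 0) (not_lt.2 h3)

lemma IsBowenMap.not_isC1Holder {f : ℝ → ℝ} (hf : IsBowenMap b α f) {s : ℝ} (hs : 0 < s) :
    ¬ IsC1Holder s (circleMap f) := by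
  rintro ⟨φ, hφ, C, hC, h⟩
  have hD := hf.isBowenDensity hα
  have hp : (0 : ℝ) < 1 / 2 := by norm_num
  -- A gap of generation `n + 1` contains a point where the derivative is twice the ratio of
  -- consecutive gap totals, within `(1 / 2) ^ n` of an endpoint where it is `2`. Dividing the
  -- Hölder bound by `2` gives these constants.
  refine hα.gapTotal_ratio_unbounded (C := C / 2) (θ := (1 / 2 : ℝ) ^ s) (by positivity)
    (by positivity) (Real.rpow_lt_one hp.le (by norm_num) hs) fun n => ?_
  obtain ⟨x, hx, hDx⟩ := hD.exists_eq_div hα 0 n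
  have hx1 := hα.gap_subset_Icc hx
  have hp1 : gapLeft b α 0 (n + 1) ∈ Icc (-1 : ℝ) 1 := by
    have h1 := hα.atomLeft_mem_atom (a := 0) (le_refl (n + 1))
    have h2 := hα.atom_subset_Icc h1
    rw [gapLeft_eq]
    rw [mem_gap] at hx
    exact ⟨by linarith [h2.1, hα.atomLength_pos (n + 2)], by linarith [hx1.2, hx.1]⟩
  have h1 := h x (gapLeft b α 0 (n + 1))
  rw [hφ.deriv_eq (hf.isC1Lift hα), hf.deriv_lift hα, hf.deriv_lift hα,
    hD.periodicDensity_eq hα hx1, hD.periodicDensity_eq hα hp1, hD.apply_gapLeft, hDx] at h1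
  have h2 : dist (x : Circle2) (gapLeft b α 0 (n + 1) : ℝ) ≤ (1 / 2) ^ n := by
    refine (circle_dist_le _ _).trans ?_
    have h3 : gapLength b α (n + 1) ≤ 2 / 2 ^ (n + 1) := by
      refine le_trans ?_ (hα.atomLength_le (n + 1))
      rw [atomLength_succ]
      linarith [hα.atomLength_pos (n + 1 + 1)]
    rw [gap, gapRight_eq_gapLeft_add] at hx
    rw [abs_of_pos (sub_pos.2 hx.1)]
    have h4 : (2 : ℝ) / 2 ^ (n + 1) = (1 / 2) ^ n := by rw [pow_succ, one_div_pow]; field_simp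
    linarith [hx.2]
  have h4 := h1.trans (mul_le_mul_of_nonneg_left (Real.rpow_le_rpow dist_nonneg h2 hs.le) hC.le)
  rw [← Real.rpow_pow_comm hp.le] at h4
  have h5 : gapLength b α n / gapLength b α (n + 1) =
      2 * (gapTotal b α n / gapTotal b α (n + 1)) := by
    have := (hα.gapTotal_pos (n + 1)).ne'
    simp only [gapLength_eq]
    field_simp
    ring
  rw [h5] at h4
  have h6 := (le_abs_self _).trans h4
  linarith

end Holder

/-! ### Invariance of the measure, transported from the shift. -/

section Invariance

variable {b : ℝ} {α : ℕ → ℝ} {f : ℝ → ℝ} (hα : IsBowenData b α) (hf : IsBowenMap b α f)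

include hα hf

lemma IsBowenMap.measurePreserving_circleMap :
    MeasurePreserving (circleMap f) (muCircle b α) (muCircle b α) := by
  have hm : Measurable (circleMap f) := (hf.isC1Lift hα).continuous.measurable
  have hp := hα.continuous_point.measurable
  have h1 : muCircle b α = bernoulliMeasure.map fun a => (point b α a : Circle2) := by
    rw [← hα.measurePreserving_coe_circle.map_eq, ← hα.map_point,
      Measure.map_map hα.measurePreserving_coe_circle.measurable hp]
    rfl
  have hp' : Measurable fun a => (point b α a : Circle2) :=
    hα.measurePreserving_coe_circle.measurable.comp hp
  refine ⟨hm, ?_⟩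
  have e : (circleMap f) ∘ (fun a => (point b α a : Circle2)) =
      (fun a => (point b α a : Circle2)) ∘ shift := by
    ext a
    simp only [Function.comp_apply]
    rw [hf.circleMap_coe hα (hα.cantorSet_subset_Icc hα.point_mem_cantorSet), hf.apply_point hα]
  rw [h1, Measure.map_map hm hp', e, ← Measure.map_map hp' continuous_shift.measurable,
    measurePreserving_shift.map_eq]

lemma IsBowenMap.pointHomeomorph_symm_restrict (hK : MapsTo f (cantorSet b α) (cantorSet b α))
    (x : cantorSet b α) : hα.pointHomeomorph.symm (hK.restrict f _ _ x) =
      shift (hα.pointHomeomorph.symm x) := by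
  obtain ⟨a, rfl⟩ := hα.pointHomeomorph.surjective x
  rw [Homeomorph.symm_apply_eq, Homeomorph.symm_apply_apply]
  exact Subtype.ext (hf.apply_point hα a)

lemma IsBowenMap.measurePreserving_restrict (hK : MapsTo f (cantorSet b α) (cantorSet b α)) :
    MeasurePreserving (hK.restrict f _ _) (muK b α) (muK b α) := by
  have h := hα.measurePreserving_pointHomeomorph_symm
  have h' : MeasurePreserving hα.pointHomeomorph.toMeasurableEquiv bernoulliMeasure (muK b α) :=
    MeasurePreserving.symm hα.pointHomeomorph.symm.toMeasurableEquiv h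
  have e : hK.restrict f _ _ =
      hα.pointHomeomorph.toMeasurableEquiv ∘ shift ∘ hα.pointHomeomorph.symm := by
    ext1 x
    have := hf.pointHomeomorph_symm_restrict hα hK x
    rw [Homeomorph.symm_apply_eq] at this
    exact this
  rw [e]
  exact h'.comp (measurePreserving_shift.comp h)

end Invariance

end Bowen

theorem mainTheorem4 (b : ℝ) (α : ℕ → ℝ) (hα : Bowen.IsBowenData b α) :
    (∃ f : ℝ → ℝ, Bowen.IsBowenMap b α f) ∧
    ∀ f : ℝ → ℝ, Bowen.IsBowenMap b α f →
      -- `f` maps `[-1, 1]` to itself and induces a circle map that is expanding and `C¹`,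
      -- but not `C¹` with Hölder derivative
      (MapsTo f (Icc (-1) 1) (Icc (-1) 1) ∧
        (∀ x ∈ Icc (-1 : ℝ) 1, Bowen.circleMap f (x : Bowen.Circle2) = (f x : Bowen.Circle2)) ∧
        Bowen.IsC1Expanding (Bowen.circleMap f) ∧
        ∀ s : ℝ, 0 < s → ¬ Bowen.IsC1Holder s (Bowen.circleMap f)) ∧
      -- `K` is a Cantor set of positive measure, dynamically defined by `f`
      (IsCompact (Bowen.cantorSet b α) ∧ Perfect (Bowen.cantorSet b α) ∧
        IsTotallyDisconnected (Bowen.cantorSet b α) ∧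
        0 < volume (Bowen.cantorSet b α) ∧
        Bowen.cantorSet b α =
          {x | ∀ n : ℕ, f^[n] x ∈ Bowen.firstAtom b 0 ∪ Bowen.firstAtom b 1}) ∧
      -- the normalized Lebesgue measure on `K` is invariant under the circle map
      (MeasurePreserving (fun x : ℝ => (x : Bowen.Circle2))
          (Bowen.muLine b α) (Bowen.muCircle b α) ∧
        MeasurePreserving (Bowen.circleMap f) (Bowen.muCircle b α) (Bowen.muCircle b α)) ∧
      -- it is invariant under the restriction of `f` to `K`, and the itinerary map conjugates this
      -- restriction to the Bernoulli shift
      ∃ hK : MapsTo f (Bowen.cantorSet b α) (Bowen.cantorSet b α),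
        MeasurePreserving (hK.restrict f _ _) (Bowen.muK b α) (Bowen.muK b α) ∧
        ∃ h : Bowen.cantorSet b α ≃ᵐ (ℕ → Fin 2),
          (∀ (x : Bowen.cantorSet b α) (n : ℕ), f^[n] x ∈ Bowen.firstAtom b (h x n)) ∧
          (∀ x : Bowen.cantorSet b α, h (hK.restrict f _ _ x) = Bowen.shift (h x)) ∧
          MeasurePreserving h (Bowen.muK b α) Bowen.bernoulliMeasure := by
  refine ⟨hα.exists_isBowenMap, fun f hf => ⟨⟨hf.mapsTo_Icc hα, fun x hx => hf.circleMap_coe hα hx,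
    hf.isC1Expanding hα, fun s hs => hf.not_isC1Holder hα hs⟩,
    ⟨hα.isCompact_cantorSet, hα.perfect_cantorSet, hα.isTotallyDisconnected_cantorSet,
      hα.volume_cantorSet_pos, hf.cantorSet_eq hα⟩,
    ⟨hα.measurePreserving_coe_circle, hf.measurePreserving_circleMap hα⟩,
    hf.mapsTo_cantorSet hα, hf.measurePreserving_restrict hα _,
    hα.pointHomeomorph.symm.toMeasurableEquiv, fun x n => ?_,
    hf.pointHomeomorph_symm_restrict hα _, hα.measurePreserving_pointHomeomorph_symm⟩⟩
  obtain ⟨a, rfl⟩ := hα.pointHomeomorph.surjective x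
  have e : hα.pointHomeomorph.symm.toMeasurableEquiv (hα.pointHomeomorph a) = a :=
    hα.pointHomeomorph.symm_apply_apply a
  rw [e]
  exact hf.iterate_point_mem_firstAtom hα a n
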